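/- **Setting.** For a probability measure $\mu$ on $\mathbb R$ with finite moments and infinite support, let $(p_j)_{j\ge 0}$ be its orthonormal polynomials ($\deg p_j=j$, positive leading coefficient, $\int p_ip_j\,d\mu=\delta_{ij}$) and let $K_n(x,y)=\sum_{j=0}^{n-1}p_j(x)p_j(y)$. The orthogonal polynomial ensemble (OPE) of size $n$ associated with $\mu$ is the probability measure $\frac1{Z_n}\prod_{i>j}(\lambda_i-\lambda_j)^2\,d\mu(\lambda_1)\cdots d\mu(\lambda_n)$ on $\mathbb R^n$. For $f:\mathbb R\to\mathbb R$, $\alpha>0$ and $x^*\in\mathbb R$ put $X^{(n)}_{f,\alpha,x^*}=\sum_{j=1}^n f(n^\alpha(\lambda_j-x^*))$. **Theorem (Local Law of Large Numbers for General OPE).** Let $\{\mu_n\}_{n\ge1}$ be probability measures on $\mathbb R$ with finite moments, and write $d\mu_n=w_n\,dx+d\mu_{n,\mathrm{sing}}$ with $w_n\ge0$ measurable and $\mu_{n,\mathrm{sing}}$ singular with respect to Lebesgue measure. Let $K_n$ be the $n$-th kernel of $\mu_n$ and $\widetilde K_n(x,y)=w_n(x)^{1/2}w_n(y)^{1/2}K_n(x,y)$.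 Let $I\subseteq\mathbb R$ be an interval with $I\subseteq\operatorname{supp}(\mu_n)$ for all $n\ge 1$, and let $x^*$ be a point in the interior of $I$. Assume: (i) for all $n\ge1$, $\mu_{n,\mathrm{sing}}(I)=0$ and $w_n(x^*)>0$; (ii) there is a function $\rho$, continuous on $I$, with $\rho(x^*)>0$, such that $\widetilde K_n(x,x)/n\to\rho(x)$ as $n\to\infty$, uniformly for $x\in I$; (iii) uniformly for $x\in I$ and $a,b$ in compact subsets of $\mathbb R$, $$\frac{\widetilde K_n\Big(x+\frac{a}{\widetilde K_n(x,x)},\,x+\frac{b}{\widetilde K_n(x,x)}\Big)}{\widetilde K_n(x,x)}\longrightarrow\frac{\sin\pi(b-a)}{\pi(b-a)}\qquad(n\to\infty),$$ where the right-hand side is $1$ if $a=b$. Let $0<\alpha<1$ and let $f:\mathbb R\to\mathbb R$ be bounded and compactly supported, with finitely many points of discontinuity. Let $(\lambda_1,\dots,\lambda_n)$ be distributed according to the OPE of size $n$ associated with $\mu_n$. Then: 1. If $f\not\equiv0$, then for every $\varepsilon>0$ and all sufficiently large $n$, $$\mathbb P\left(n^\alpha\left|\frac{X^{(n)}_{f,\alpha,x^*}}{n}-\frac{\mathbb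 E X^{(n)}_{f,\alpha,x^*}}{n}\right|\ge\varepsilon\right)\le 2\exp\left(-\frac{\varepsilon\,n^{1-\alpha}}{6\|f\|_\infty}\right),\qquad \|f\|_\infty=\sup_{x\in\mathbb R}|f(x)|.$$ 2. However the ensembles of the different sizes $n\geq 1$ are realised on a common probability space, almost surely $$\lim_{n\to\infty}n^\alpha\left(\frac1nX^{(n)}_{f,\alpha,x^*}-\int_I f\big(n^\alpha(x-x^*)\big)\rho(x)\,dx\right)=0 .$$ -/

import Mathlib

open MeasureTheory ProbabilityTheory Filter Topology

namespace OPE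

/-- The measure `μ` has finite moments of all orders. -/
def FiniteMoments (μ : Measure ℝ) : Prop :=
  ∀ k : ℕ, Integrable (fun x : ℝ => x ^ k) μ

/-- The `j`-th orthonormal polynomial `p_j` of `μ`: the Gram-Schmidt orthonormalisation of
`1, x, x², …` with respect to the bilinear form `(p, q) ↦ ∫ p q dμ`. If `μ` has finite moments and
infinite support, then `p_j` is the unique sequence with `deg p_j = j`, positive leading
coefficients and `∫ p_i p_j dμ = δ_{ij}` (see `orthonormalPoly_spec`). -/
noncomputable def orthonormalPoly (μ : Measure ℝ) (j : ℕ) : Polynomial ℝ :=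
  let P : Polynomial ℝ := Polynomial.X ^ j -
    ∑ i : Fin j, Polynomial.C (∫ x, x ^ j * (orthonormalPoly μ i).eval x ∂μ) *
      orthonormalPoly μ i
  Polynomial.C (Real.sqrt (∫ x, (P.eval x) ^ 2 ∂μ))⁻¹ * P
termination_by j
decreasing_by all_goals exact i.isLt

/-- The Christoffel-Darboux kernel `K_n(x, y) = ∑_{j < n} p_j(x) p_j(y)` of `μ`. -/
noncomputable def cdKernel (μ : Measure ℝ) (n : ℕ) (x y : ℝ) : ℝ :=
  ∑ j ∈ Finset.range n, (orthonormalPoly μ j).eval x * (orthonormalPoly μ j).eval y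

/-- The weighted kernel `w(x)^{1/2} w(y)^{1/2} K_n(x, y)`. -/
noncomputable def weightedKernel (μ : Measure ℝ) (w : ℝ → ℝ) (n : ℕ) (x y : ℝ) : ℝ :=
  Real.sqrt (w x) * Real.sqrt (w y) * cdKernel μ n x y

/-- The squared Vandermonde product `∏_{i > j} (l_i - l_j)²`. -/
def vandermondeSq {n : ℕ} (l : Fin n → ℝ) : ℝ :=
  ∏ i : Fin n, ∏ j ∈ Finset.Iio i, (l i - l j) ^ 2

/-- The normalising constant `Z_n` of the orthogonal polynomial ensemble. -/
noncomputable def partitionFunction (μ : Measure ℝ) (n : ℕ) : ENNReal :=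
  ∫⁻ l : Fin n → ℝ, ENNReal.ofReal (vandermondeSq l) ∂(Measure.pi fun _ : Fin n => μ)

/-- The orthogonal polynomial ensemble of size `n` associated with `μ`: the measure
`Z_n⁻¹ ∏_{i > j} (l_i - l_j)² dμ(l_1) ⋯ dμ(l_n)` on `ℝⁿ`. -/
noncomputable def ensemble (μ : Measure ℝ) (n : ℕ) : Measure (Fin n → ℝ) :=
  (partitionFunction μ n)⁻¹ •
    (Measure.pi fun _ : Fin n => μ).withDensity fun l => ENNReal.ofReal (vandermondeSq l)

/-- The local linear statistic `X_{f,α,x*}^{(n)} = ∑_j f(n^α (l_j - x*))`. -/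
noncomputable def localStat (f : ℝ → ℝ) (α xs : ℝ) (n : ℕ) (l : Fin n → ℝ) : ℝ :=
  ∑ j : Fin n, f ((n : ℝ) ^ α * (l j - xs))

/-- The supremum norm `‖f‖_∞` of a bounded function. -/
noncomputable def supNorm (f : ℝ → ℝ) : ℝ := ⨆ x : ℝ, |f x|

theorem FiniteMoments.integrable_eval {μ : Measure ℝ} (h : FiniteMoments μ)
    (p : Polynomial ℝ) : Integrable (fun x => p.eval x) μ := by
  simp only [Polynomial.eval_eq_sum_range]
  exact integrable_finsetSum _ fun k _ => (h k).const_mul _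

theorem integral_sq_pos {μ : Measure ℝ} (h : FiniteMoments μ) (hs : μ.support.Infinite)
    {p : Polynomial ℝ} (hp : p ≠ 0) : 0 < ∫ x, (p.eval x) ^ 2 ∂μ := by
  have hint : Integrable (fun x => (p.eval x) ^ 2) μ := by
    have h2 := h.integrable_eval (p ^ 2)
    simp only [Polynomial.eval_pow] at h2
    exact h2
  refine lt_of_le_of_ne (integral_nonneg fun x => sq_nonneg _) fun h0 => ?_
  have hae := (integral_eq_zero_iff_of_nonneg (fun x => sq_nonneg _) hint).1 h0.symm
  refine hs ((p.roots.toFinset.finite_toSet).subset ?_)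
  refine Measure.support_subset_of_isClosed (Set.Finite.isClosed (Finset.finite_toSet _)) ?_
  filter_upwards [hae] with x hx
  simpa [hp] using hx

/-- `orthonormalPoly μ` is the sequence of orthonormal polynomials of `μ`. -/
theorem orthonormalPoly_spec {μ : Measure ℝ} (h : FiniteMoments μ) (hs : μ.support.Infinite) :
    (∀ j, (orthonormalPoly μ j).natDegree = j) ∧
    (∀ j, 0 < (orthonormalPoly μ j).leadingCoeff) ∧
    (∀ i j, ∫ x, (orthonormalPoly μ i).eval x * (orthonormalPoly μ j).eval x ∂μ =
      if i = j then 1 else 0) := by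
  have key : ∀ j, (orthonormalPoly μ j).natDegree = j ∧ 0 < (orthonormalPoly μ j).leadingCoeff ∧
      (∀ i < j, ∫ x, (orthonormalPoly μ i).eval x * (orthonormalPoly μ j).eval x ∂μ = 0) ∧
      ∫ x, (orthonormalPoly μ j).eval x * (orthonormalPoly μ j).eval x ∂μ = 1 := by
    intro j
    induction j using Nat.strong_induction_on with
    | _ j ih =>
    set S : Polynomial ℝ :=
      ∑ i : Fin j, Polynomial.C (∫ x, x ^ j * (orthonormalPoly μ i).eval x ∂μ) *
        orthonormalPoly μ i with hS
    set P : Polynomial ℝ := Polynomial.X ^ j - S with hP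
    have hpj : orthonormalPoly μ j =
        Polynomial.C (Real.sqrt (∫ x, (P.eval x) ^ 2 ∂μ))⁻¹ * P := by
      rw [orthonormalPoly]
    have hSdeg : S.degree < (j : WithBot ℕ) := by
      rw [← Polynomial.mem_degreeLT, hS]
      refine Submodule.sum_mem _ fun i _ => ?_
      rw [Polynomial.mem_degreeLT]
      rw [← Polynomial.smul_eq_C_mul]
      refine (Polynomial.degree_smul_le _ _).trans_lt ?_
      refine Polynomial.degree_le_natDegree.trans_lt ?_
      rw [(ih i i.isLt).1]
      exact_mod_cast i.isLt
    have hmon : P.Monic := Polynomial.monic_X_pow_sub hSdeg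
    have hPdeg : P.natDegree = j := by
      refine Polynomial.natDegree_eq_of_degree_eq_some ?_
      rw [hP, Polynomial.degree_sub_eq_left_of_degree_lt] <;> rw [Polynomial.degree_X_pow]
      exact hSdeg
    have hpos := integral_sq_pos h hs hmon.ne_zero
    have hsq := Real.sqrt_pos.2 hpos
    set c : ℝ := (Real.sqrt (∫ x, (P.eval x) ^ 2 ∂μ))⁻¹ with hc
    have hcpos : 0 < c := inv_pos.2 hsq
    refine ⟨?_, ?_, ?_, ?_⟩
    · rw [hpj, Polynomial.natDegree_C_mul hcpos.ne', hPdeg]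
    · rw [hpj, Polynomial.leadingCoeff_mul, Polynomial.leadingCoeff_C, hmon.leadingCoeff]
      simpa using hcpos
    · intro i hi
      have hint : ∀ q r : Polynomial ℝ, Integrable (fun x => q.eval x * r.eval x) μ := by
        intro q r
        simpa using h.integrable_eval (q * r)
      have hSi : ∫ x, (orthonormalPoly μ i).eval x * S.eval x ∂μ =
          ∫ x, x ^ j * (orthonormalPoly μ i).eval x ∂μ := by
        have h1 : ∀ x, (orthonormalPoly μ i).eval x * S.eval x =
            ∑ k : Fin j, (∫ x, x ^ j * (orthonormalPoly μ k).eval x ∂μ) *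
              ((orthonormalPoly μ i).eval x * (orthonormalPoly μ k).eval x) := by
          intro x
          rw [hS, Polynomial.eval_finsetSum, Finset.mul_sum]
          refine Finset.sum_congr rfl fun k _ => ?_
          simp only [Polynomial.eval_mul, Polynomial.eval_C]
          ring
        simp only [h1]
        rw [integral_finsetSum _ fun k _ => (hint _ _).const_mul _]
        simp only [integral_const_mul]
        rw [Finset.sum_eq_single (⟨i, hi⟩ : Fin j)]
        · simp [(ih i hi).2.2.2]
        · intro k _ hk
          have hki : (k : ℕ) ≠ i := fun e => hk (Fin.ext e)
          rcases lt_or_gt_of_ne hki with hlt | hgt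
          · have := (ih i hi).2.2.1 k hlt
            simp only [mul_comm ((orthonormalPoly μ (k : ℕ)).eval _)] at this
            rw [this, mul_zero]
          · rw [(ih k k.isLt).2.2.1 i hgt, mul_zero]
        · simp
      have h2 : ∀ x, (orthonormalPoly μ i).eval x * (orthonormalPoly μ j).eval x =
          c * (x ^ j * (orthonormalPoly μ i).eval x - (orthonormalPoly μ i).eval x * S.eval x) := by
        intro x
        rw [hpj, hP]
        simp only [Polynomial.eval_mul, Polynomial.eval_C, Polynomial.eval_sub,
          Polynomial.eval_pow, Polynomial.eval_X]
        ring
      simp only [h2]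
      rw [integral_const_mul, integral_sub ?_ (hint _ _), hSi, sub_self, mul_zero]
      simpa using hint (Polynomial.X ^ j) (orthonormalPoly μ i)
    · have h3 : ∀ x, (orthonormalPoly μ j).eval x * (orthonormalPoly μ j).eval x =
          c ^ 2 * (P.eval x) ^ 2 := by
        intro x
        rw [hpj]
        simp only [Polynomial.eval_mul, Polynomial.eval_C]
        ring
      simp only [h3]
      rw [integral_const_mul, hc, inv_pow, Real.sq_sqrt hpos.le, inv_mul_cancel₀ hpos.ne']
  refine ⟨fun j => (key j).1, fun j => (key j).2.1, fun i j => ?_⟩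
  rcases lt_trichotomy i j with hlt | rfl | hgt
  · rw [if_neg hlt.ne, (key j).2.2.1 i hlt]
  · rw [if_pos rfl, (key i).2.2.2]
  · rw [if_neg hgt.ne']
    simp only [mul_comm ((orthonormalPoly μ i).eval _)]
    exact (key i).2.2.1 j hgt

end OPE

/-! Linear statistics of the ensemble are determinantal. By Andréief's identity, `∏ h(λ_j)` has
expectation `det (gram μ n h)`, where `gram μ n h` is the compression `P h P` of multiplication by
`h` to polynomials of degree `< n` (`integral_prod_ensemble`).

Take `h = exp (t f)` and pass to an orthonormal eigenbasis `u_i` of `A = P f P`, with eigenvalues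
`a_i`. The determinant of the positive semidefinite matrix `e^{-tA/2} (P e^{tf} P) e^{-tA/2}` is at
most `exp (trace - n)`, and its diagonal entries are `∫ e^{t(f - a_i)} u_i² dμ`. The linear term in
`t` vanishes because `∫ f u_i² dμ = a_i`, so the centred exponential moment is at most `exp (t² V)`
with `V = tr (P f² P) - tr ((P f P)²)`, provided `|t| · 2‖f‖_∞ ≤ 1` (`det_gram_exp_le`). Chernoff's
bound with `t = 1 / (3‖f‖_∞)` then gives part 1 as soon as `V = o(n^{1-α})`.

For that, `V = ∫ f(x) ∫ (f(x) - f(y)) K_n(x,y)² dμ(y) dμ(x)`. The total mass of `K_n(x,·)²` is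
`K_n(x,x)`. Sine kernel universality and `∫ sinc²(πb) db = 1` show that nearly all of it lies within
distance `O(1/n)` of `x`. This is far below the scale `n^{-α}` on which `f` varies, so the inner
integral is negligible wherever `f` is continuous; dominated convergence concludes
(`tendsto_gramVar`).

Part 2 follows from Borel–Cantelli, since the bounds `exp (-c n^{1-α})` are summable, and from
convergence of the means (`tendsto_mean_sub`). -/

namespace OPE

/-! ### Andréief's identity -/

section Andreief

variable {n : ℕ} {μ : Measure ℝ} [SigmaFinite μ] {φ ψ : Fin n → ℝ → ℝ}

/-- Each term of the double Leibniz expansion is a product over the coordinates of `l`, so Fubini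
applies term by term. -/
theorem det_mul_det_eq_sum (φ ψ : Fin n → ℝ → ℝ) (l : Fin n → ℝ) :
    (Matrix.of fun i j => φ i (l j)).det * (Matrix.of fun i j => ψ i (l j)).det =
      ∑ τ : Equiv.Perm (Fin n), ∑ σ : Equiv.Perm (Fin n),
        (((σ.sign : ℤ) : ℝ) * ((τ.sign : ℤ) : ℝ)) * ∏ j, (φ (σ j) (l j) * ψ (τ j) (l j)) := by
  rw [Matrix.det_apply', Matrix.det_apply', Finset.sum_mul_sum, Finset.sum_comm]
  refine Finset.sum_congr rfl fun τ _ => Finset.sum_congr rfl fun σ _ => ?_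
  simp only [Matrix.of_apply, Finset.prod_mul_distrib]
  ring

theorem integrable_det_mul_det (h : ∀ i j, Integrable (fun x => φ i x * ψ j x) μ) :
    Integrable (fun l : Fin n → ℝ =>
      (Matrix.of fun i j => φ i (l j)).det * (Matrix.of fun i j => ψ i (l j)).det)
      (Measure.pi fun _ => μ) := by
  simp only [det_mul_det_eq_sum]
  refine integrable_finsetSum _ fun τ _ => integrable_finsetSum _ fun σ _ => ?_
  exact (Integrable.fintype_prod (f := fun j x => φ (σ j) x * ψ (τ j) x)
    fun j => h _ _).const_mul _

/-- Andréief's identity. -/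
theorem integral_det_mul_det (h : ∀ i j, Integrable (fun x => φ i x * ψ j x) μ) :
    ∫ l : Fin n → ℝ, (Matrix.of fun i j => φ i (l j)).det *
        (Matrix.of fun i j => ψ i (l j)).det ∂(Measure.pi fun _ => μ) =
      n.factorial * (Matrix.of fun i j => ∫ x, φ i x * ψ j x ∂μ).det := by
  set G : Matrix (Fin n) (Fin n) ℝ := Matrix.of fun i j => ∫ x, φ i x * ψ j x ∂μ with hG
  have hint : ∀ σ τ : Equiv.Perm (Fin n), Integrable (fun l : Fin n → ℝ =>
      (((σ.sign : ℤ) : ℝ) * ((τ.sign : ℤ) : ℝ)) * ∏ j, (φ (σ j) (l j) * ψ (τ j) (l j)))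
      (Measure.pi fun _ => μ) := fun σ τ =>
    (Integrable.fintype_prod (f := fun j x => φ (σ j) x * ψ (τ j) x) fun j => h _ _).const_mul _
  simp only [det_mul_det_eq_sum]
  rw [integral_finsetSum _ fun τ _ => integrable_finsetSum _ fun σ _ => hint σ τ]
  have key : ∀ τ : Equiv.Perm (Fin n), ∫ l : Fin n → ℝ, ∑ σ : Equiv.Perm (Fin n),
        (((σ.sign : ℤ) : ℝ) * ((τ.sign : ℤ) : ℝ)) * ∏ j, (φ (σ j) (l j) * ψ (τ j) (l j))
        ∂(Measure.pi fun _ => μ) = G.det := by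
    intro τ
    rw [integral_finsetSum _ fun σ _ => hint σ τ]
    have h1 : ∀ σ : Equiv.Perm (Fin n), ∫ l : Fin n → ℝ,
        (((σ.sign : ℤ) : ℝ) * ((τ.sign : ℤ) : ℝ)) * ∏ j, (φ (σ j) (l j) * ψ (τ j) (l j))
        ∂(Measure.pi fun _ => μ) =
        ((τ.sign : ℤ) : ℝ) * (((σ.sign : ℤ) : ℝ) * ∏ j, (G.submatrix id τ) (σ j) j) := by
      intro σ
      rw [integral_const_mul,
        integral_fintype_prod_eq_prod (fun j x => φ (σ j) x * ψ (τ j) x)]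
      simp only [hG, Matrix.submatrix_apply, Matrix.of_apply, id]
      ring
    simp only [h1]
    rw [← Finset.mul_sum, ← Matrix.det_apply', Matrix.det_permute', ← mul_assoc, ← Int.cast_mul,
      Int.units_coe_mul_self, Int.cast_one, one_mul]
  simp only [key]
  rw [Finset.sum_const, Finset.card_univ, Fintype.card_perm, Fintype.card_fin, nsmul_eq_mul]

end Andreief

/-! ### Multiplicative statistics as determinants of compressions -/

/-- The compression of multiplication by `h` to the span of the first `n` orthonormal
polynomials. -/
noncomputable def gram (μ : Measure ℝ) (n : ℕ) (h : ℝ → ℝ) : Matrix (Fin n) (Fin n) ℝ :=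
  Matrix.of fun i j =>
    ∫ x, h x * ((orthonormalPoly μ i).eval x * (orthonormalPoly μ j).eval x) ∂μ

/-- The product of the leading coefficients of the first `n` orthonormal polynomials. -/
noncomputable def leadProd (μ : Measure ℝ) (n : ℕ) : ℝ :=
  ∏ i : Fin n, (orthonormalPoly μ i).leadingCoeff

variable {μ : Measure ℝ}

theorem leadProd_pos (hm : FiniteMoments μ) (hs : μ.support.Infinite) (n : ℕ) :
    0 < leadProd μ n :=
  Finset.prod_pos fun i _ => (orthonormalPoly_spec hm hs).2.1 i

theorem vandermondeSq_eq_det {n : ℕ} (l : Fin n → ℝ) :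
    vandermondeSq l = (Matrix.vandermonde l).det ^ 2 := by
  rw [Matrix.det_vandermonde, vandermondeSq, ← Finset.prod_pow]
  simp only [← Finset.prod_pow]
  refine Finset.prod_comm' fun i j => ?_
  simp

theorem vandermondeSq_nonneg {n : ℕ} (l : Fin n → ℝ) : 0 ≤ vandermondeSq l := by
  rw [vandermondeSq_eq_det]; positivity

theorem continuous_vandermondeSq {n : ℕ} : Continuous (vandermondeSq (n := n)) := by
  unfold vandermondeSq; fun_prop

/-- The passage from monomials to orthonormal polynomials is triangular, with the leading
coefficients on the diagonal. -/
theorem det_orthonormalPoly (hm : FiniteMoments μ) (hs : μ.support.Infinite) {n : ℕ}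
    (l : Fin n → ℝ) :
    (Matrix.of fun i j : Fin n => (orthonormalPoly μ i).eval (l j)).det =
      leadProd μ n * (Matrix.vandermonde l).det := by
  obtain ⟨hdeg, hlc, -⟩ := orthonormalPoly_spec hm hs
  have h1 := Matrix.eval_matrixOfPolynomials_eq_vandermonde_mul_matrixOfPolynomials l
    (fun i : Fin n => orthonormalPoly μ i) (fun i => (hdeg i).le)
  rw [← Matrix.det_transpose]
  have h2 : (Matrix.of fun i j : Fin n => (orthonormalPoly μ i).eval (l j)).transpose =
      Matrix.of fun i j : Fin n => (orthonormalPoly μ j).eval (l i) := rfl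
  rw [h2, h1, Matrix.det_mul, mul_comm, leadProd]
  congr 1
  rw [Matrix.det_of_isUpperTriangular]
  · refine Finset.prod_congr rfl fun i _ => ?_
    simp only [Matrix.of_apply]
    rw [Polynomial.leadingCoeff, hdeg]
  · exact Matrix.matrixOfPolynomials_blockTriangular _ fun i => (hdeg i).le

theorem FiniteMoments.integrable_mul_eval {h : ℝ → ℝ} (hm : FiniteMoments μ)
    (hh : Measurable h) {M : ℝ} (hM : ∀ x, |h x| ≤ M) (p q : Polynomial ℝ) :
    Integrable (fun x => h x * (p.eval x * q.eval x)) μ := by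
  have := hm.integrable_eval (p * q)
  simp only [Polynomial.eval_mul] at this
  exact this.bdd_mul hh.aestronglyMeasurable (ae_of_all _ fun x => by simpa using hM x)

/-- The weights `h (l j)` are absorbed into the columns of one of the two determinants, which is the
shape Andréief's identity turns into `gram μ n h`. -/
theorem vandermondeSq_mul_prod_eq (hm : FiniteMoments μ) (hs : μ.support.Infinite) {n : ℕ}
    (h : ℝ → ℝ) (l : Fin n → ℝ) :
    vandermondeSq l * ∏ j, h (l j) = (leadProd μ n ^ 2)⁻¹ *
      ((Matrix.of fun i j : Fin n => h (l j) * (orthonormalPoly μ i).eval (l j)).det *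
      (Matrix.of fun i j : Fin n => (orthonormalPoly μ i).eval (l j)).det) := by
  have h1 := Matrix.det_mul_row (fun j => h (l j))
    (Matrix.of fun i j : Fin n => (orthonormalPoly μ i).eval (l j))
  simp only [Matrix.of_apply] at h1
  have := (leadProd_pos hm hs n).ne'
  rw [h1, det_orthonormalPoly hm hs, vandermondeSq_eq_det]
  field_simp

theorem integrable_vandermondeSq_mul_prod [IsProbabilityMeasure μ] (hm : FiniteMoments μ)
    (hs : μ.support.Infinite) {h : ℝ → ℝ} (hh : Measurable h) {M : ℝ} (hM : ∀ x, |h x| ≤ M)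
    {n : ℕ} :
    Integrable (fun l : Fin n → ℝ => vandermondeSq l * ∏ j, h (l j))
      (Measure.pi fun _ => μ) := by
  simp only [vandermondeSq_mul_prod_eq hm hs h]
  refine Integrable.const_mul (integrable_det_mul_det
    (φ := fun i x => h x * (orthonormalPoly μ i).eval x)
    (ψ := fun i x => (orthonormalPoly μ i).eval x) fun i j => ?_) _
  simpa only [mul_assoc] using hm.integrable_mul_eval hh hM _ _

theorem integral_vandermondeSq_mul_prod [IsProbabilityMeasure μ] (hm : FiniteMoments μ)
    (hs : μ.support.Infinite) {h : ℝ → ℝ} (hh : Measurable h) {M : ℝ} (hM : ∀ x, |h x| ≤ M)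
    {n : ℕ} :
    ∫ l : Fin n → ℝ, vandermondeSq l * ∏ j, h (l j) ∂(Measure.pi fun _ => μ) =
      (leadProd μ n ^ 2)⁻¹ * (n.factorial * (gram μ n h).det) := by
  simp only [vandermondeSq_mul_prod_eq hm hs h]
  rw [integral_const_mul, integral_det_mul_det
    (φ := fun (i : Fin n) x => h x * (orthonormalPoly μ i).eval x)
    (ψ := fun (i : Fin n) x => (orthonormalPoly μ i).eval x)]
  · simp only [mul_assoc, gram]
  · intro i j
    simpa only [mul_assoc] using hm.integrable_mul_eval hh hM _ _

theorem gram_one (hm : FiniteMoments μ) (hs : μ.support.Infinite) (n : ℕ) :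
    gram μ n (fun _ => 1) = 1 := by
  ext i j
  simp only [gram, one_mul, Matrix.of_apply, (orthonormalPoly_spec hm hs).2.2, Matrix.one_apply,
    Fin.ext_iff]

theorem partitionFunction_eq [IsProbabilityMeasure μ] (hm : FiniteMoments μ)
    (hs : μ.support.Infinite) (n : ℕ) :
    partitionFunction μ n = ENNReal.ofReal ((leadProd μ n ^ 2)⁻¹ * n.factorial) := by
  have h1 := integrable_vandermondeSq_mul_prod hm hs (h := fun _ => 1) measurable_const
    (M := 1) (by simp) (n := n)
  have h2 := integral_vandermondeSq_mul_prod hm hs (h := fun _ => 1) measurable_const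
    (M := 1) (by simp) (n := n)
  simp only [Finset.prod_const_one, mul_one, gram_one hm hs, Matrix.det_one] at h1 h2
  rw [← h2, partitionFunction, ofReal_integral_eq_lintegral_ofReal h1
    (ae_of_all _ vandermondeSq_nonneg)]

theorem isProbabilityMeasure_ensemble [IsProbabilityMeasure μ] (hm : FiniteMoments μ)
    (hs : μ.support.Infinite) (n : ℕ) : IsProbabilityMeasure (ensemble μ n) := by
  constructor
  rw [ensemble, Measure.smul_apply, withDensity_apply _ MeasurableSet.univ, Measure.restrict_univ,
    smul_eq_mul]
  change (partitionFunction μ n)⁻¹ * partitionFunction μ n = 1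
  have := leadProd_pos hm hs n
  rw [partitionFunction_eq hm hs]
  refine ENNReal.inv_mul_cancel ?_ ENNReal.ofReal_ne_top
  rw [ne_eq, ENNReal.ofReal_eq_zero, not_le]
  positivity

/-- The expectation of a multiplicative statistic is a determinant. -/
theorem integral_prod_ensemble [IsProbabilityMeasure μ] (hm : FiniteMoments μ)
    (hs : μ.support.Infinite) {h : ℝ → ℝ} (hh : Measurable h) {M : ℝ} (hM : ∀ x, |h x| ≤ M)
    (n : ℕ) :
    ∫ l, ∏ j, h (l j) ∂(ensemble μ n) = (gram μ n h).det := by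
  have hpos := leadProd_pos hm hs n
  rw [ensemble, integral_smul_measure, integral_withDensity_eq_integral_toReal_smul
    (by exact (continuous_vandermondeSq.measurable).ennreal_ofReal)
    (ae_of_all _ fun _ => ENNReal.ofReal_lt_top)]
  simp only [ENNReal.toReal_ofReal (vandermondeSq_nonneg _), smul_eq_mul]
  rw [integral_vandermondeSq_mul_prod hm hs hh hM, partitionFunction_eq hm hs, ENNReal.toReal_inv,
    ENNReal.toReal_ofReal (by positivity)]
  field_simp

/-- The function `∑ k, v k * p_k`. -/
noncomputable def combo (μ : Measure ℝ) {n : ℕ} (v : Fin n → ℝ) (x : ℝ) : ℝ :=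
  ∑ k, v k * (orthonormalPoly μ k).eval x

theorem mul_combo_sq (h : ℝ → ℝ) {n : ℕ} (v : Fin n → ℝ) (x : ℝ) :
    h x * combo μ v x ^ 2 = ∑ k, ∑ k', v k * v k' *
      (h x * ((orthonormalPoly μ k).eval x * (orthonormalPoly μ k').eval x)) := by
  rw [sq, combo, Finset.sum_mul_sum, Finset.mul_sum]
  refine Finset.sum_congr rfl fun i _ => ?_
  rw [Finset.mul_sum]
  refine Finset.sum_congr rfl fun j _ => ?_
  ring

theorem integrable_mul_combo_sq (hm : FiniteMoments μ) {h : ℝ → ℝ} (hh : Measurable h) {M : ℝ}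
    (hM : ∀ x, |h x| ≤ M) {n : ℕ} (v : Fin n → ℝ) :
    Integrable (fun x => h x * combo μ v x ^ 2) μ := by
  simp only [mul_combo_sq]
  exact integrable_finsetSum _ fun i _ => integrable_finsetSum _ fun j _ =>
    (hm.integrable_mul_eval hh hM _ _).const_mul _

theorem integral_mul_combo_sq (hm : FiniteMoments μ) {h : ℝ → ℝ} (hh : Measurable h) {M : ℝ}
    (hM : ∀ x, |h x| ≤ M) {n : ℕ} (v : Fin n → ℝ) :
    ∫ x, h x * combo μ v x ^ 2 ∂μ = v ⬝ᵥ (gram μ n h).mulVec v := by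
  have hint := fun i j : Fin n => (hm.integrable_mul_eval hh hM
    (orthonormalPoly μ i) (orthonormalPoly μ j)).const_mul (v i * v j)
  simp only [mul_combo_sq]
  rw [integral_finsetSum _ fun i _ => integrable_finsetSum _ fun j _ => hint i j]
  simp only [dotProduct, Matrix.mulVec]
  refine Finset.sum_congr rfl fun i _ => ?_
  rw [integral_finsetSum _ fun j _ => hint i j, Finset.mul_sum]
  refine Finset.sum_congr rfl fun j _ => ?_
  rw [integral_const_mul, gram, Matrix.of_apply]
  ring

theorem gram_isHermitian (n : ℕ) (h : ℝ → ℝ) : (gram μ n h).IsHermitian := by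
  ext i j
  simp only [gram, Matrix.conjTranspose_apply, Matrix.of_apply, star_trivial]
  simp only [mul_comm ((orthonormalPoly μ (j : ℕ)).eval _)]

theorem gram_posSemidef (hm : FiniteMoments μ) {h : ℝ → ℝ} (hh : Measurable h) {M : ℝ}
    (hM : ∀ x, |h x| ≤ M) (h0 : ∀ x, 0 ≤ h x) (n : ℕ) : (gram μ n h).PosSemidef := by
  refine Matrix.PosSemidef.of_dotProduct_mulVec_nonneg (gram_isHermitian n h) fun v => ?_
  rw [star_trivial, ← integral_mul_combo_sq hm hh hM]
  exact integral_nonneg fun x => mul_nonneg (h0 x) (sq_nonneg _)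

/-! ### Exponential moments and concentration of linear statistics -/

/-- Apply `x ≤ exp (x - 1)` to each eigenvalue. The bound is sharp at the identity matrix. -/
theorem det_le_exp_trace_sub {n : ℕ} {A : Matrix (Fin n) (Fin n) ℝ} (hA : A.PosSemidef) :
    A.det ≤ Real.exp (A.trace - n) := by
  rw [hA.isHermitian.det_eq_prod_eigenvalues, hA.isHermitian.trace_eq_sum_eigenvalues]
  have h1 : (∑ i, (hA.isHermitian.eigenvalues i : ℝ)) - n =
      ∑ i, (hA.isHermitian.eigenvalues i - 1) := by simp
  simp only [RCLike.ofReal_real_eq_id, id]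
  rw [h1, Real.exp_sum]
  refine Finset.prod_le_prod (fun i _ => hA.eigenvalues_nonneg i) fun i _ => ?_
  have := Real.add_one_le_exp (hA.isHermitian.eigenvalues i - 1)
  linarith

/-- The variance of the linear statistic of `f`, in terms of compressions. -/
noncomputable def gramVar (μ : Measure ℝ) (n : ℕ) (f : ℝ → ℝ) : ℝ :=
  (gram μ n fun x => f x ^ 2).trace - (gram μ n f * gram μ n f).trace

/-- The determinant of the compression of `exp (t f)` against the exponential of `t` times the
compression of `f`. -/
theorem det_gram_exp_le [IsProbabilityMeasure μ] (hm : FiniteMoments μ)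
    (hs : μ.support.Infinite) {f : ℝ → ℝ} (hf : Measurable f) {M : ℝ} (hM : ∀ x, |f x| ≤ M)
    {t : ℝ} (ht : |t| * (2 * M) ≤ 1) (n : ℕ) :
    Real.exp (-t * (gram μ n f).trace) * (gram μ n fun x => Real.exp (t * f x)).det ≤
      Real.exp (t ^ 2 * gramVar μ n f) := by
  set A := gram μ n f with hAdef
  have hA : A.IsHermitian := gram_isHermitian n f
  set U : Matrix (Fin n) (Fin n) ℝ := ↑hA.eigenvectorUnitary with hU
  set a : Fin n → ℝ := hA.eigenvalues with ha
  set B := gram μ n fun x => Real.exp (t * f x) with hB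
  -- This is `e^{-tA/2}` in the eigenbasis of `A`; splitting `e^{-tA}` into two half factors keeps
  -- the conjugated matrix positive semidefinite.
  set D : Matrix (Fin n) (Fin n) ℝ := Matrix.diagonal fun i => Real.exp (-t * a i / 2) with hD
  have hM0 : 0 ≤ M := (abs_nonneg _).trans (hM 0)
  have hexpb : ∀ x, |Real.exp (t * f x)| ≤ Real.exp (|t| * M) := fun x => by
    rw [abs_of_pos (Real.exp_pos _), Real.exp_le_exp]
    refine (le_abs_self _).trans ?_
    rw [abs_mul]
    exact mul_le_mul_of_nonneg_left (hM x) (abs_nonneg _)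
  have hexpm : Measurable fun x => Real.exp (t * f x) := by fun_prop
  have hf2 : ∀ x, |f x ^ 2| ≤ M ^ 2 := fun x => by
    rw [abs_pow]; exact pow_le_pow_left₀ (abs_nonneg _) (hM x) 2
  have hUU : U.transpose * U = 1 := by
    have := Unitary.coe_star_mul_self hA.eigenvectorUnitary
    rwa [Matrix.star_eq_conjTranspose, Matrix.conjTranspose_eq_transpose_of_trivial] at this
  have hdiag : U.transpose * A * U = Matrix.diagonal a := by
    have := hA.conjStarAlgAut_star_eigenvectorUnitary
    rw [Unitary.conjStarAlgAut_star_apply, Matrix.star_eq_conjTranspose,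
      Matrix.conjTranspose_eq_transpose_of_trivial] at this
    simpa using this
  have hUU' : U * U.transpose = 1 := mul_eq_one_comm.1 hUU
  have hentry : ∀ (G : Matrix (Fin n) (Fin n) ℝ) (i : Fin n),
      (U.transpose * G * U) i i = (fun k => U k i) ⬝ᵥ G.mulVec (fun k => U k i) := by
    intro G i
    rw [Matrix.mul_assoc, Matrix.mul_apply]
    rfl
  have htr : ∀ G : Matrix (Fin n) (Fin n) ℝ, (U.transpose * G * U).trace = G.trace := by
    intro G
    rw [Matrix.trace_mul_comm, ← Matrix.mul_assoc, hUU', Matrix.one_mul]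
  set u : Fin n → ℝ → ℝ := fun i => combo μ fun k => U k i with hu
  have hq : ∀ {h : ℝ → ℝ} (_ : Measurable h) {C : ℝ} (_ : ∀ x, |h x| ≤ C) (i : Fin n),
      ∫ x, h x * u i x ^ 2 ∂μ = (U.transpose * gram μ n h * U) i i := by
    intro h hh C hC i
    rw [integral_mul_combo_sq hm hh hC, hentry]
  have hui : ∀ {h : ℝ → ℝ} (_ : Measurable h) {C : ℝ} (_ : ∀ x, |h x| ≤ C) (i : Fin n),
      Integrable (fun x => h x * u i x ^ 2) μ := fun hh _ hC i =>
    integrable_mul_combo_sq hm hh hC _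
  have hu1 : ∀ i, ∫ x, u i x ^ 2 ∂μ = 1 := by
    intro i
    have := hq (h := fun _ => 1) measurable_const (C := 1) (by simp) i
    simpa [gram_one hm hs, hUU] using this
  have hu1i : ∀ i, Integrable (fun x => u i x ^ 2) μ := by
    intro i
    simpa using hui (h := fun _ => 1) measurable_const (C := 1) (by simp) i
  have huf : ∀ i, ∫ x, f x * u i x ^ 2 ∂μ = a i := by
    intro i
    rw [hq hf hM i, ← hAdef, hdiag, Matrix.diagonal_apply_eq]
  have ha_le : ∀ i, |a i| ≤ M := by
    intro i
    rw [← huf i]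
    refine (abs_integral_le_integral_abs).trans ?_
    calc ∫ x, |f x * u i x ^ 2| ∂μ ≤ ∫ x, M * u i x ^ 2 ∂μ := by
          refine integral_mono (hui hf hM i).abs ((hu1i i).const_mul M) fun x => ?_
          simp only [abs_mul, abs_of_nonneg (sq_nonneg (u i x))]
          exact mul_le_mul_of_nonneg_right (hM x) (sq_nonneg _)
      _ = M := by rw [integral_const_mul, hu1 i, mul_one]
  -- In the eigenbasis, `gramVar` is the sum of the variances of `f` under the probability densities
  -- `u_i²`.
  have hvar : gramVar μ n f = ∑ i, (∫ x, f x ^ 2 * u i x ^ 2 ∂μ - a i ^ 2) := by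
    rw [gramVar, ← hAdef, ← htr, ← htr (A * A)]
    have h1 : U.transpose * (A * A) * U = Matrix.diagonal a * Matrix.diagonal a := by
      rw [← hdiag]
      calc U.transpose * (A * A) * U = U.transpose * A * 1 * A * U := by
            simp only [Matrix.mul_assoc, Matrix.one_mul]
        _ = _ := by rw [← hUU']; simp only [Matrix.mul_assoc]
    rw [h1, Matrix.diagonal_mul_diagonal, Matrix.trace_diagonal, Matrix.trace,
      ← Finset.sum_sub_distrib]
    refine Finset.sum_congr rfl fun i _ => ?_
    rw [Matrix.diag_apply, ← hq (by fun_prop) hf2 i]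
    ring
  -- Uses `e^y ≤ 1 + y + y²` for `|y| ≤ 1` at `y = t (f - a_i)`; since `|f - a_i| ≤ 2M`, this is
  -- what `ht` is for. The term in `y` integrates to zero against `u_i²`.
  have hterm : ∀ i, Real.exp (-t * a i) * ∫ x, Real.exp (t * f x) * u i x ^ 2 ∂μ ≤
      1 + t ^ 2 * (∫ x, f x ^ 2 * u i x ^ 2 ∂μ - a i ^ 2) := by
    intro i
    rw [← integral_const_mul]
    have i1 := hu1i i
    have i2 := hui hf hM i
    have i3 := hui (by fun_prop) hf2 i
    have e1 : ∀ x, Real.exp (-t * a i) * (Real.exp (t * f x) * u i x ^ 2) ≤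
        (1 - t * a i + t ^ 2 * a i ^ 2) * u i x ^ 2 +
          ((t - 2 * t ^ 2 * a i) * (f x * u i x ^ 2) + t ^ 2 * (f x ^ 2 * u i x ^ 2)) := by
      intro x
      have hy : |t * (f x - a i)| ≤ 1 := by
        rw [abs_mul]
        refine le_trans (mul_le_mul_of_nonneg_left ?_ (abs_nonneg t)) ht
        refine (abs_sub _ _).trans ?_
        linarith [hM x, ha_le i]
      have h2 := (abs_le.1 (Real.abs_exp_sub_one_sub_id_le hy)).2
      have h3 : Real.exp (t * (f x - a i)) ≤
          1 + t * (f x - a i) + (t * (f x - a i)) ^ 2 := by linarith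
      have h4 := mul_le_mul_of_nonneg_right h3 (sq_nonneg (u i x))
      rw [← mul_assoc, ← Real.exp_add]
      have h5 : -t * a i + t * f x = t * (f x - a i) := by ring
      rw [h5]
      refine h4.trans (le_of_eq ?_)
      ring
    have i4 : Integrable (fun x => (t - 2 * t ^ 2 * a i) * (f x * u i x ^ 2) +
        t ^ 2 * (f x ^ 2 * u i x ^ 2)) μ := (i2.const_mul _).add (i3.const_mul _)
    refine (integral_mono ((hui hexpm hexpb i).const_mul _)
      ((i1.const_mul _).add i4) e1).trans (le_of_eq ?_)
    simp only [Pi.add_apply]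
    rw [integral_add (i1.const_mul _) i4,
      integral_add (i2.const_mul _) (i3.const_mul _), integral_const_mul, integral_const_mul,
      integral_const_mul, hu1 i, huf i]
    ring
  have hpsd : (D * (U.transpose * B * U) * D).PosSemidef := by
    have h1 := (gram_posSemidef hm hexpm hexpb (fun x => (Real.exp_pos _).le) n)
    have h2 := h1.conjTranspose_mul_mul_same (U * D)
    rw [Matrix.conjTranspose_eq_transpose_of_trivial, Matrix.transpose_mul, hD,
      Matrix.diagonal_transpose, ← hD] at h2
    simpa only [Matrix.mul_assoc] using h2
  have hdet : (D * (U.transpose * B * U) * D).det = Real.exp (-t * A.trace) * B.det := by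
    have h1 : U.transpose.det * U.det = 1 := by rw [← Matrix.det_mul, hUU, Matrix.det_one]
    have h2 : D.det * D.det = Real.exp (-t * A.trace) := by
      rw [← Matrix.det_mul, hD, Matrix.diagonal_mul_diagonal, Matrix.det_diagonal]
      simp only [← Real.exp_add]
      rw [← Real.exp_sum, ← htr, hdiag, Matrix.trace_diagonal, Finset.mul_sum]
      congr 1
      refine Finset.sum_congr rfl fun i _ => ?_
      ring
    simp only [Matrix.det_mul]
    calc D.det * (U.transpose.det * B.det * U.det) * D.det =
        (D.det * D.det) * (U.transpose.det * U.det) * B.det := by ring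
      _ = _ := by rw [h1, h2, mul_one]
  have htrace : (D * (U.transpose * B * U) * D).trace =
      ∑ i, Real.exp (-t * a i) * ∫ x, Real.exp (t * f x) * u i x ^ 2 ∂μ := by
    rw [Matrix.trace]
    refine Finset.sum_congr rfl fun i _ => ?_
    rw [Matrix.diag_apply, hD, Matrix.mul_diagonal, Matrix.diagonal_mul, hq hexpm hexpb i, ← hB,
      mul_right_comm, ← Real.exp_add]
    congr 2
    ring
  rw [← hdet]
  refine (det_le_exp_trace_sub hpsd).trans (Real.exp_le_exp.2 ?_)
  rw [htrace, hvar, Finset.mul_sum]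
  have := Finset.sum_le_sum fun i (_ : i ∈ Finset.univ) => hterm i
  rw [Finset.sum_add_distrib] at this
  simp only [Finset.sum_const, Finset.card_univ, Fintype.card_fin, nsmul_eq_mul, mul_one] at this
  linarith

/-- The exponential moment of a centred linear statistic. -/
theorem integral_exp_linearStat_le [IsProbabilityMeasure μ] (hm : FiniteMoments μ)
    (hs : μ.support.Infinite) {f : ℝ → ℝ} (hf : Measurable f) {M : ℝ} (hM : ∀ x, |f x| ≤ M)
    {t : ℝ} (ht : |t| * (2 * M) ≤ 1) (n : ℕ) :
    ∫ l : Fin n → ℝ, Real.exp (t * (∑ j, f (l j) - (gram μ n f).trace)) ∂(ensemble μ n) ≤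
      Real.exp (t ^ 2 * gramVar μ n f) := by
  refine le_trans (le_of_eq ?_) (det_gram_exp_le hm hs hf hM ht n)
  rw [← integral_prod_ensemble hm hs (by fun_prop) (M := Real.exp (|t| * M)) (fun x => ?_) n,
    ← integral_const_mul]
  · refine integral_congr_ae (ae_of_all _ fun l => ?_)
    simp only
    rw [← Real.exp_sum, ← Real.exp_add, ← Finset.mul_sum]
    congr 1
    ring
  · rw [abs_of_pos (Real.exp_pos _), Real.exp_le_exp]
    refine (le_abs_self _).trans ?_
    rw [abs_mul]
    exact mul_le_mul_of_nonneg_left (hM x) (abs_nonneg _)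

theorem abs_linearStat_le {f : ℝ → ℝ} {M : ℝ} (hM : ∀ x, |f x| ≤ M) {n : ℕ} (l : Fin n → ℝ) :
    |∑ j, f (l j)| ≤ n * M := by
  refine (Finset.abs_sum_le_sum_abs _ _).trans ?_
  refine (Finset.sum_le_sum fun j _ => hM (l j)).trans ?_
  simp

theorem integrable_exp_linearStat {ν : Measure (Fin n → ℝ)} [IsFiniteMeasure ν]
    {f : ℝ → ℝ} (hf : Measurable f) {M : ℝ} (hM : ∀ x, |f x| ≤ M) (t m : ℝ) :
    Integrable (fun l : Fin n → ℝ => Real.exp (t * (∑ j, f (l j) - m))) ν := by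
  refine Integrable.of_bound (C := Real.exp (|t| * (n * M + |m|)))
    (Measurable.aestronglyMeasurable (by fun_prop)) (ae_of_all _ fun l => ?_)
  rw [Real.norm_eq_abs, abs_of_pos (Real.exp_pos _), Real.exp_le_exp]
  refine (le_abs_self _).trans ?_
  rw [abs_mul]
  refine mul_le_mul_of_nonneg_left ?_ (abs_nonneg _)
  exact (abs_sub _ _).trans (by linarith [abs_linearStat_le hM l])

theorem integrable_linearStat {ν : Measure (Fin n → ℝ)} [IsFiniteMeasure ν]
    {f : ℝ → ℝ} (hf : Measurable f) {M : ℝ} (hM : ∀ x, |f x| ≤ M) :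
    Integrable (fun l : Fin n → ℝ => ∑ j, f (l j)) ν :=
  Integrable.of_bound (C := n * M) (Measurable.aestronglyMeasurable (by fun_prop))
    (ae_of_all _ fun l => abs_linearStat_le hM l)

/-- The expectation of a linear statistic is the trace of a compression. -/
theorem integral_linearStat [IsProbabilityMeasure μ] (hm : FiniteMoments μ)
    (hs : μ.support.Infinite) {f : ℝ → ℝ} (hf : Measurable f) {M : ℝ} (hM : ∀ x, |f x| ≤ M)
    (n : ℕ) : ∫ l : Fin n → ℝ, ∑ j, f (l j) ∂(ensemble μ n) = (gram μ n f).trace := by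
  have := isProbabilityMeasure_ensemble hm hs n
  set m := (gram μ n f).trace with hmdef
  set V := gramVar μ n f
  set E := ∫ l : Fin n → ℝ, ∑ j, f (l j) ∂(ensemble μ n) with hE
  have hM0 : 0 ≤ M := (abs_nonneg _).trans (hM 0)
  -- Since `1 + x ≤ e^x`, the exponential moment bound controls the mean: `exp (t² V) - t (E - m)`
  -- is minimal at `t = 0`, and its vanishing derivative there forces `E = m`.
  have key : ∀ t : ℝ, |t| * (2 * M) ≤ 1 → 1 + t * (E - m) ≤ Real.exp (t ^ 2 * V) := by
    intro t ht
    refine le_trans ?_ (integral_exp_linearStat_le hm hs hf hM ht n)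
    have h1 : 1 + t * (E - m) =
        ∫ l : Fin n → ℝ, (1 + t * (∑ j, f (l j) - m)) ∂(ensemble μ n) := by
      have hi := (integrable_linearStat (ν := ensemble μ n) hf hM)
      have hi' : Integrable (fun l : Fin n → ℝ => ∑ j, f (l j) - m) (ensemble μ n) :=
        hi.sub (integrable_const _)
      rw [integral_add (integrable_const _) (hi'.const_mul _),
        integral_const_mul, integral_sub hi (integrable_const _)]
      simp [hE]
    rw [h1]
    have hi := (integrable_linearStat (ν := ensemble μ n) hf hM)
    refine integral_mono ((integrable_const _).add ((hi.sub (integrable_const _)).const_mul _))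
      (integrable_exp_linearStat hf hM t m) fun l => ?_
    have := Real.add_one_le_exp (t * (∑ j, f (l j) - m))
    simp only
    linarith
  have hmin : IsLocalMin (fun t : ℝ => Real.exp (t ^ 2 * V) - t * (E - m)) 0 := by
    have hc : ∀ᶠ t : ℝ in 𝓝 0, |t| * (2 * M) < 1 :=
      (Continuous.tendsto (by fun_prop : Continuous fun t : ℝ => |t| * (2 * M)) 0).eventually_lt_const
        (by simp)
    filter_upwards [hc] with t ht
    have := key t ht.le
    simp only [ne_eq, OfNat.ofNat_ne_zero, not_false_eq_true, zero_pow, zero_mul, Real.exp_zero,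
      sub_zero]
    linarith
  have hd : HasDerivAt (fun t : ℝ => Real.exp (t ^ 2 * V) - t * (E - m))
      (Real.exp (0 ^ 2 * V) * ((2 : ℕ) * (0 : ℝ) ^ (2 - 1) * 1 * V) - 1 * (E - m)) 0 :=
    ((((hasDerivAt_id (0 : ℝ)).pow 2).mul_const V).exp).sub ((hasDerivAt_id 0).mul_const (E - m))
  have := hmin.hasDerivAt_eq_zero hd
  norm_num at this
  linarith

/-- Concentration of linear statistics. -/
theorem measureReal_linearStat_sub_integral_ge_le [IsProbabilityMeasure μ] (hm : FiniteMoments μ)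
    (hs : μ.support.Infinite) {f : ℝ → ℝ} (hf : Measurable f) {M : ℝ} (hM : ∀ x, |f x| ≤ M)
    {t : ℝ} (ht0 : 0 ≤ t) (ht : t * (2 * M) ≤ 1) (n : ℕ) (s : ℝ) :
    (ensemble μ n).real {l | s ≤ |∑ j, f (l j) - ∫ l', ∑ j, f (l' j) ∂(ensemble μ n)|} ≤
      2 * Real.exp (-t * s + t ^ 2 * gramVar μ n f) := by
  have := isProbabilityMeasure_ensemble hm hs n
  rw [integral_linearStat hm hs hf hM]
  set m := (gram μ n f).trace
  set X : (Fin n → ℝ) → ℝ := fun l => ∑ j, f (l j) - m with hX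
  have h1 : (ensemble μ n).real {l | s ≤ X l} ≤
      Real.exp (-t * s + t ^ 2 * gramVar μ n f) := by
    refine (measure_ge_le_exp_mul_mgf s ht0 (integrable_exp_linearStat hf hM t m)).trans ?_
    rw [Real.exp_add]
    refine mul_le_mul_of_nonneg_left ?_ (Real.exp_pos _).le
    exact integral_exp_linearStat_le hm hs hf hM (by rwa [abs_of_nonneg ht0]) n
  have h2 : (ensemble μ n).real {l | X l ≤ -s} ≤
      Real.exp (-t * s + t ^ 2 * gramVar μ n f) := by
    refine (measure_le_le_exp_mul_mgf (-s) (neg_nonpos.2 ht0)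
      (integrable_exp_linearStat hf hM (-t) m)).trans ?_
    rw [Real.exp_add, neg_neg, mul_neg, neg_mul, ← neg_sq t]
    refine mul_le_mul_of_nonneg_left ?_ (Real.exp_pos _).le
    exact integral_exp_linearStat_le hm hs hf hM (by rwa [abs_neg, abs_of_nonneg ht0]) n
  have h3 : {l | s ≤ |∑ j, f (l j) - m|} ⊆ {l | s ≤ X l} ∪ {l | X l ≤ -s} := by
    intro l hl
    rcases le_abs.1 (Set.mem_ofPred_eq ▸ hl) with h | h
    · exact Or.inl h
    · exact Or.inr (by simp only [Set.mem_ofPred_eq, hX]; linarith)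
  refine (measureReal_mono h3).trans ((measureReal_union_le _ _).trans ?_)
  linarith

/-! ### The integral of the squared sine kernel -/

theorem integral_exp_mul_I_symm (c : ℝ) :
    ∫ t in (-(1 / 2) : ℝ)..(1 / 2), Complex.exp (c * t * Complex.I) = Real.sinc (c / 2) := by
  rcases eq_or_ne c 0 with rfl | hc
  · norm_num
  have h1 := intervalIntegral.smul_integral_comp_mul_left (a := -(1 / 2)) (b := 1 / 2)
    (fun t : ℝ => Complex.exp (t * Complex.I)) c
  have h2 : c * -(1 / 2) = -(c / 2) := by ring
  have h3 : c * (1 / 2) = c / 2 := by ring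
  rw [h2, h3, integral_exp_mul_I_eq_sinc] at h1
  have hc' : (c : ℂ) ≠ 0 := by exact_mod_cast hc
  have h4 : (2 : ℂ) * ((c / 2 : ℝ) : ℂ) = c := by push_cast; ring
  rw [h4, Complex.real_smul] at h1
  simpa using mul_left_cancel₀ hc' h1

/-- Parseval on `[-1/2, 1/2]` for the unimodular function `t ↦ e^{2πixt}`, whose `n`-th Fourier
coefficient is `sinc (π (x - n))`. -/
theorem hasSum_sinc_sq (x : ℝ) :
    HasSum (fun n : ℤ => Real.sinc (Real.pi * (x - n)) ^ 2) 1 := by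
  have hab : (-(1 / 2) : ℝ) < 1 / 2 := by norm_num
  have hnorm : ∀ t : ℝ, ‖Complex.exp ((2 * Real.pi * x : ℝ) * t * Complex.I)‖ = 1 := by
    intro t
    rw [← Complex.ofReal_mul, Complex.norm_exp_ofReal_mul_I]
  have h := hasSum_sq_fourierCoeffOn hab
    (f := fun t : ℝ => Complex.exp ((2 * Real.pi * x : ℝ) * t * Complex.I))
    (MemLp.of_bound (Continuous.aestronglyMeasurable (by fun_prop)) 1
      (ae_of_all _ fun t => (hnorm t).le))
  convert h using 1
  · ext n
    rw [fourierCoeffOn_eq_integral]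
    have h1 : ∀ t : ℝ, fourier (-n) (t : AddCircle ((1 / 2 : ℝ) - -(1 / 2))) •
        Complex.exp ((2 * Real.pi * x : ℝ) * t * Complex.I) =
        Complex.exp ((2 * Real.pi * (x - n) : ℝ) * t * Complex.I) := by
      intro t
      rw [fourier_coe_apply, smul_eq_mul, ← Complex.exp_add]
      congr 1
      push_cast
      ring
    simp only [h1]
    rw [integral_exp_mul_I_symm]
    have h2 : 2 * Real.pi * (x - n) / 2 = Real.pi * (x - n) := by ring
    rw [h2]
    norm_num
  · simp only [hnorm]
    norm_num

/-- Cut the line into unit intervals and translate them all to `(0, 1]`: the periodised integrand is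
identically `1` by `hasSum_sinc_sq`. -/
theorem lintegral_sinc_sq :
    ∫⁻ x : ℝ, ENNReal.ofReal (Real.sinc (Real.pi * x) ^ 2) = 1 := by
  have hc : Continuous fun x : ℝ => Real.sinc (Real.pi * x) ^ 2 := by
    have := Real.continuous_sinc; fun_prop
  set g : ℝ → ENNReal := fun x => ENNReal.ofReal (Real.sinc (Real.pi * x) ^ 2) with hg
  have hgm : Measurable g := hc.measurable.ennreal_ofReal
  have h1 : ∫⁻ x, g x = ∑' n : ℤ, ∫⁻ x in Set.Ioc (n : ℝ) (n + 1), g x := by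
    rw [← lintegral_iUnion (fun n => measurableSet_Ioc) (Set.pairwise_disjoint_Ioc_intCast ℝ),
      iUnion_Ioc_intCast, Measure.restrict_univ]
  have h2 : ∀ n : ℤ, ∫⁻ x in Set.Ioc (n : ℝ) (n + 1), g x =
      ∫⁻ x in Set.Ioc (0 : ℝ) 1, g (x + n) := by
    intro n
    have := (measurePreserving_add_right volume (n : ℝ)).setLIntegral_comp_preimage
      (measurableSet_Ioc (a := (n : ℝ)) (b := n + 1)) hgm
    rw [← this]
    congr 2
    simp
  rw [h1]
  simp only [h2]
  rw [← lintegral_tsum fun n => (by fun_prop : Measurable fun x => g (x + (n : ℤ))).aemeasurable]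
  have h3 : ∀ x : ℝ, ∑' n : ℤ, g (x + n) = 1 := by
    intro x
    have hs := (hasSum_sinc_sq x)
    rw [← (Equiv.neg ℤ).tsum_eq]
    simp only [Equiv.neg_apply, Int.cast_neg, ← sub_eq_add_neg, hg]
    rw [← ENNReal.ofReal_tsum_of_nonneg (fun n => sq_nonneg _) hs.summable, hs.tsum_eq,
      ENNReal.ofReal_one]
  simp [h3]

theorem tendsto_integral_sinc_sq :
    Tendsto (fun A : ℝ => ∫ x in -A..A, Real.sinc (Real.pi * x) ^ 2) atTop (𝓝 1) := by
  have hc : Continuous fun x : ℝ => Real.sinc (Real.pi * x) ^ 2 := by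
    have := Real.continuous_sinc; fun_prop
  have hi : Integrable fun x : ℝ => Real.sinc (Real.pi * x) ^ 2 := by
    refine ⟨hc.aestronglyMeasurable, ?_⟩
    rw [hasFiniteIntegral_iff_ofReal (ae_of_all _ fun x => sq_nonneg _), lintegral_sinc_sq]
    exact ENNReal.one_lt_top
  have h1 : ∫ x : ℝ, Real.sinc (Real.pi * x) ^ 2 = 1 := by
    rw [integral_eq_lintegral_of_nonneg_ae (ae_of_all _ fun x => sq_nonneg _)
      hc.aestronglyMeasurable, lintegral_sinc_sq, ENNReal.toReal_one]
  rw [← h1]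
  exact intervalIntegral_tendsto_integral hi tendsto_neg_atTop_atBot tendsto_id

/-! ### The kernel, its reproducing property and the variance -/

theorem continuous_cdKernel (μ : Measure ℝ) (n : ℕ) :
    Continuous fun p : ℝ × ℝ => cdKernel μ n p.1 p.2 := by
  unfold cdKernel
  refine continuous_finsetSum _ fun j _ => ?_
  exact ((orthonormalPoly μ j).continuous.comp continuous_fst).mul
    ((orthonormalPoly μ j).continuous.comp continuous_snd)

theorem cdKernel_self_nonneg (μ : Measure ℝ) (n : ℕ) (x : ℝ) : 0 ≤ cdKernel μ n x x :=
  Finset.sum_nonneg fun _ _ => mul_self_nonneg _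

theorem cdKernel_eq_sum_fin (μ : Measure ℝ) (n : ℕ) (x y : ℝ) :
    cdKernel μ n x y = ∑ j : Fin n, (orthonormalPoly μ j).eval x * (orthonormalPoly μ j).eval y :=
  Finset.sum_range fun j => (orthonormalPoly μ j).eval x * (orthonormalPoly μ j).eval y

theorem cdKernel_sq (μ : Measure ℝ) (n : ℕ) (x y : ℝ) :
    cdKernel μ n x y ^ 2 = ∑ i : Fin n, ∑ j : Fin n,
      ((orthonormalPoly μ i).eval x * (orthonormalPoly μ j).eval x) *
        ((orthonormalPoly μ i).eval y * (orthonormalPoly μ j).eval y) := by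
  rw [sq, cdKernel_eq_sum_fin, Finset.sum_mul_sum]
  refine Finset.sum_congr rfl fun i _ => Finset.sum_congr rfl fun j _ => ?_
  ring

theorem mul_cdKernel_sq (μ : Measure ℝ) (n : ℕ) (h : ℝ → ℝ) (x y : ℝ) :
    h y * cdKernel μ n x y ^ 2 = ∑ i : Fin n, ∑ j : Fin n,
      ((orthonormalPoly μ i).eval x * (orthonormalPoly μ j).eval x) *
        (h y * ((orthonormalPoly μ i).eval y * (orthonormalPoly μ j).eval y)) := by
  rw [cdKernel_sq, Finset.mul_sum]
  refine Finset.sum_congr rfl fun i _ => ?_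
  rw [Finset.mul_sum]
  refine Finset.sum_congr rfl fun j _ => ?_
  ring

theorem integrable_mul_cdKernel_sq (hm : FiniteMoments μ) {h : ℝ → ℝ} (hh : Measurable h)
    {M : ℝ} (hM : ∀ x, |h x| ≤ M) (n : ℕ) (x : ℝ) :
    Integrable (fun y => h y * cdKernel μ n x y ^ 2) μ := by
  simp only [mul_cdKernel_sq]
  exact integrable_finsetSum _ fun i _ => integrable_finsetSum _ fun j _ =>
    (hm.integrable_mul_eval hh hM _ _).const_mul _

theorem integral_mul_cdKernel_sq (hm : FiniteMoments μ) {h : ℝ → ℝ} (hh : Measurable h)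
    {M : ℝ} (hM : ∀ x, |h x| ≤ M) (n : ℕ) (x : ℝ) :
    ∫ y, h y * cdKernel μ n x y ^ 2 ∂μ = ∑ i : Fin n, ∑ j : Fin n,
      gram μ n h i j * ((orthonormalPoly μ i).eval x * (orthonormalPoly μ j).eval x) := by
  have hint := fun i j : Fin n => (hm.integrable_mul_eval hh hM
    (orthonormalPoly μ i) (orthonormalPoly μ j)).const_mul
      ((orthonormalPoly μ i).eval x * (orthonormalPoly μ j).eval x)
  simp only [mul_cdKernel_sq]
  rw [integral_finsetSum _ fun i _ => integrable_finsetSum _ fun j _ => hint i j]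
  refine Finset.sum_congr rfl fun i _ => ?_
  rw [integral_finsetSum _ fun j _ => hint i j]
  refine Finset.sum_congr rfl fun j _ => ?_
  rw [integral_const_mul, gram, Matrix.of_apply, mul_comm]

theorem integrable_cdKernel_sq (hm : FiniteMoments μ) (n : ℕ) (x : ℝ) :
    Integrable (fun y => cdKernel μ n x y ^ 2) μ := by
  simpa using integrable_mul_cdKernel_sq hm (h := fun _ => 1) measurable_const (M := 1)
    (by simp) n x

/-- The reproducing property on the diagonal. -/
theorem integral_cdKernel_sq (hm : FiniteMoments μ) (hs : μ.support.Infinite) (n : ℕ) (x : ℝ) :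
    ∫ y, cdKernel μ n x y ^ 2 ∂μ = cdKernel μ n x x := by
  have := integral_mul_cdKernel_sq hm (h := fun _ => 1) measurable_const (M := 1) (by simp) n x
  simp only [gram_one hm hs, one_mul, Matrix.one_apply, ite_mul, zero_mul, Finset.sum_ite_eq,
    Finset.mem_univ, if_true] at this
  rw [this, cdKernel_eq_sum_fin]

theorem integrable_mul_cdKernel_self (hm : FiniteMoments μ) {h : ℝ → ℝ} (hh : Measurable h)
    {M : ℝ} (hM : ∀ x, |h x| ≤ M) (n : ℕ) :
    Integrable (fun x => h x * cdKernel μ n x x) μ := by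
  simp only [cdKernel, Finset.mul_sum]
  exact integrable_finsetSum _ fun j _ => hm.integrable_mul_eval hh hM _ _

theorem trace_gram (hm : FiniteMoments μ) {h : ℝ → ℝ} (hh : Measurable h)
    {M : ℝ} (hM : ∀ x, |h x| ≤ M) (n : ℕ) :
    (gram μ n h).trace = ∫ x, h x * cdKernel μ n x x ∂μ := by
  simp only [cdKernel_eq_sum_fin, Finset.mul_sum]
  rw [integral_finsetSum _ fun j _ => hm.integrable_mul_eval hh hM _ _]
  rfl

/-- The deviation of multiplication by `f` from commuting with the projection of kernel
`cdKernel μ n`, at the point `x`. -/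
noncomputable def defect (μ : Measure ℝ) (n : ℕ) (f : ℝ → ℝ) (x : ℝ) : ℝ :=
  ∫ y, (f x - f y) * cdKernel μ n x y ^ 2 ∂μ

theorem measurable_defect [SFinite μ] (n : ℕ) {f : ℝ → ℝ} (hf : Measurable f) :
    Measurable (defect μ n f) := by
  refine (StronglyMeasurable.integral_prod_right (Measurable.stronglyMeasurable ?_)).measurable
  exact ((hf.comp measurable_fst).sub (hf.comp measurable_snd)).mul
    ((continuous_cdKernel μ n).measurable.pow_const 2)

/-- Expand the inner integral using the reproducing property. The unsymmetrised form is chosen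
because the outer factor `f x` confines `x` to the support of `f`, where the local hypotheses apply,
while `y` is left free to range over all of `μ`. -/
theorem gramVar_eq (hm : FiniteMoments μ) (hs : μ.support.Infinite) {f : ℝ → ℝ}
    (hf : Measurable f) {M : ℝ} (hM : ∀ x, |f x| ≤ M) (n : ℕ) :
    gramVar μ n f = ∫ x, f x * defect μ n f x ∂μ := by
  have hf2 : ∀ x, |f x ^ 2| ≤ M ^ 2 := fun x => by
    rw [abs_pow]; exact pow_le_pow_left₀ (abs_nonneg _) (hM x) 2
  have hfm2 : Measurable fun x => f x ^ 2 := by fun_prop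
  have h1 : ∀ x, f x * defect μ n f x = f x ^ 2 * cdKernel μ n x x -
      ∑ i : Fin n, ∑ j : Fin n, gram μ n f i j *
        (f x * ((orthonormalPoly μ i).eval x * (orthonormalPoly μ j).eval x)) := by
    intro x
    simp only [defect, sub_mul]
    rw [integral_sub ((integrable_cdKernel_sq hm n x).const_mul _)
      (integrable_mul_cdKernel_sq hm hf hM n x), integral_const_mul, integral_cdKernel_sq hm hs,
      integral_mul_cdKernel_sq hm hf hM, mul_sub, Finset.mul_sum]
    congr 1
    · ring
    · refine Finset.sum_congr rfl fun i _ => ?_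
      rw [Finset.mul_sum]
      refine Finset.sum_congr rfl fun j _ => ?_
      ring
  have hint := fun i j : Fin n => (hm.integrable_mul_eval hf hM
    (orthonormalPoly μ i) (orthonormalPoly μ j)).const_mul (gram μ n f i j)
  simp only [h1]
  rw [integral_sub (integrable_mul_cdKernel_self hm hfm2 hf2 n)
    (integrable_finsetSum _ fun i _ => integrable_finsetSum _ fun j _ => hint i j),
    ← trace_gram hm hfm2 hf2, gramVar,
    integral_finsetSum _ fun i _ => integrable_finsetSum _ fun j _ => hint i j]
  congr 1
  refine Finset.sum_congr rfl fun i _ => ?_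
  rw [integral_finsetSum _ fun j _ => hint i j, Matrix.diag_apply, Matrix.mul_apply]
  refine Finset.sum_congr rfl fun j _ => ?_
  have h2 : gram μ n f j i = gram μ n f i j := (gram_isHermitian n f).apply i j
  rw [integral_const_mul, h2]
  rfl

theorem integrable_sub_mul_cdKernel_sq (hm : FiniteMoments μ) {f : ℝ → ℝ}
    (hf : Measurable f) {M : ℝ} (hM : ∀ x, |f x| ≤ M) (n : ℕ) (x : ℝ) :
    Integrable (fun y => (f x - f y) * cdKernel μ n x y ^ 2) μ := by
  refine integrable_mul_cdKernel_sq hm (h := fun y => f x - f y) (by fun_prop) (M := 2 * M)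
    (fun y => ?_) n x
  exact (abs_sub _ _).trans (by linarith [hM x, hM y])

/-- The reproducing property turns the trivial bound `|f x - f y| ≤ 2M` into the domination needed
for passing to the limit. -/
theorem abs_defect_le (hm : FiniteMoments μ) (hs : μ.support.Infinite) {f : ℝ → ℝ}
    (hf : Measurable f) {M : ℝ} (hM : ∀ x, |f x| ≤ M) (n : ℕ) (x : ℝ) :
    |defect μ n f x| ≤ 2 * M * cdKernel μ n x x := by
  refine abs_integral_le_integral_abs.trans ?_
  rw [← integral_cdKernel_sq hm hs, ← integral_const_mul]
  refine integral_mono (integrable_sub_mul_cdKernel_sq hm hf hM n x).abs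
    ((integrable_cdKernel_sq hm n x).const_mul _) fun y => ?_
  simp only [abs_mul, abs_of_nonneg (sq_nonneg (cdKernel μ n x y))]
  exact mul_le_mul_of_nonneg_right ((abs_sub _ _).trans (by linarith [hM x, hM y])) (sq_nonneg _)

theorem weightedKernel_self {w : ℝ → ℝ} (hw : ∀ x, 0 ≤ w x) (n : ℕ) (x : ℝ) :
    weightedKernel μ w n x x = w x * cdKernel μ n x x := by
  rw [weightedKernel, Real.mul_self_sqrt (hw x)]

theorem weightedKernel_sq {w : ℝ → ℝ} (hw : ∀ x, 0 ≤ w x) (n : ℕ) (x y : ℝ) :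
    weightedKernel μ w n x y ^ 2 = w x * (w y * cdKernel μ n x y ^ 2) := by
  rw [weightedKernel, mul_pow, mul_pow, Real.sq_sqrt (hw x), Real.sq_sqrt (hw y), mul_assoc]

/-- Split the `y`-integral at distance `A / k` from `x`, with `k` the weighted diagonal kernel. Near
`x` the oscillation of `f` is at most `e`. The far mass is the known total minus the near mass, so
no decay of the kernel away from `x` has to be known. -/
theorem abs_weighted_defect_le_of_near (hm : FiniteMoments μ) (hs : μ.support.Infinite)
    {w : ℝ → ℝ} (hwm : Measurable w) (hw : ∀ x, 0 ≤ w x)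
    (hwμ : volume.withDensity (fun x => ENNReal.ofReal (w x)) ≤ μ) {f : ℝ → ℝ}
    (hf : Measurable f) {M : ℝ} (hM : ∀ x, |f x| ≤ M) {n : ℕ} {x A e : ℝ} (hA : 0 ≤ A)
    (he : 0 ≤ e) (hk : 0 < weightedKernel μ w n x x)
    (hnear : ∀ y, |y - x| ≤ A / weightedKernel μ w n x x → |f x - f y| ≤ e) :
    |w x * defect μ n f x| ≤ e * weightedKernel μ w n x x + 2 * M * (weightedKernel μ w n x x *
      (1 - ∫ b in -A..A, (weightedKernel μ w n x (x + b / weightedKernel μ w n x x) /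
        weightedKernel μ w n x x) ^ 2)) := by
  set k := weightedKernel μ w n x x with hkdef
  have hM0 : 0 ≤ M := (abs_nonneg _).trans (hM 0)
  set S : Set ℝ := Set.Icc (x - A / k) (x + A / k) with hS
  have hSm : MeasurableSet S := measurableSet_Icc
  have hI := integrable_cdKernel_sq hm n x
  have hle : x - A / k ≤ x + A / k := by
    have : 0 ≤ A / k := by positivity
    linarith
  -- Only a lower bound on the near mass is needed, so discarding the singular part of `μ` is
  -- harmless; the substitution `y = x + b / k` produces the factor `k`.
  have hnearint : k * ∫ b in -A..A, (weightedKernel μ w n x (x + b / k) / k) ^ 2 ≤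
      w x * ∫ y in S, cdKernel μ n x y ^ 2 ∂μ := by
    have h1 : ∫ y in S, cdKernel μ n x y ^ 2 ∂(volume.withDensity
        fun x => ENNReal.ofReal (w x)) ≤ ∫ y in S, cdKernel μ n x y ^ 2 ∂μ :=
      integral_mono_measure (Measure.restrict_mono le_rfl hwμ)
        (ae_of_all _ fun y => sq_nonneg _) hI.integrableOn
    refine le_trans (le_of_eq ?_) (mul_le_mul_of_nonneg_left h1 (hw x))
    rw [setIntegral_withDensity_eq_setIntegral_toReal_smul hwm.ennreal_ofReal
      (ae_of_all _ fun _ => ENNReal.ofReal_lt_top) _ hSm, ← integral_const_mul]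
    simp only [ENNReal.toReal_ofReal (hw _), smul_eq_mul, ← weightedKernel_sq hw]
    rw [hS, integral_Icc_eq_integral_Ioc, ← intervalIntegral.integral_of_le hle]
    have h2 := intervalIntegral.integral_comp_add_mul (a := -A) (b := A)
      (fun y => weightedKernel μ w n x y ^ 2) (inv_ne_zero hk.ne') x
    have e1 : x + k⁻¹ * -A = x - A / k := by ring
    have e2 : x + k⁻¹ * A = x + A / k := by ring
    rw [e1, e2, inv_inv, smul_eq_mul] at h2
    simp only [div_pow]
    rw [intervalIntegral.integral_div]
    simp only [div_eq_inv_mul] at h2 ⊢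
    rw [h2]
    field_simp
  have hsplit : ∫ y in Sᶜ, cdKernel μ n x y ^ 2 ∂μ =
      cdKernel μ n x x - ∫ y in S, cdKernel μ n x y ^ 2 ∂μ := by
    rw [← integral_cdKernel_sq hm hs, ← integral_add_compl hSm hI]
    ring
  have hbound : |defect μ n f x| ≤
      e * cdKernel μ n x x + 2 * M * ∫ y in Sᶜ, cdKernel μ n x y ^ 2 ∂μ := by
    refine abs_integral_le_integral_abs.trans ?_
    rw [← integral_cdKernel_sq hm hs, ← integral_const_mul, ← integral_const_mul,
      ← integral_indicator hSm.compl, ← integral_add (hI.const_mul _)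
        ((hI.const_mul _).indicator hSm.compl)]
    refine integral_mono (integrable_sub_mul_cdKernel_sq hm hf hM n x).abs
      ((hI.const_mul _).add ((hI.const_mul _).indicator hSm.compl)) fun y => ?_
    simp only [abs_mul, abs_of_nonneg (sq_nonneg (cdKernel μ n x y))]
    by_cases hy : y ∈ S
    · rw [Set.indicator_of_notMem (by simpa using hy), add_zero]
      refine mul_le_mul_of_nonneg_right (hnear y ?_) (sq_nonneg _)
      rw [abs_le]
      constructor <;> linarith [hy.1, hy.2]
    · rw [Set.indicator_of_mem (by simpa using hy)]
      have h1 : |f x - f y| ≤ 2 * M := (abs_sub _ _).trans (by linarith [hM x, hM y])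
      have h2 := mul_le_mul_of_nonneg_right h1 (sq_nonneg (cdKernel μ n x y))
      have h3 : 0 ≤ e * cdKernel μ n x y ^ 2 := by positivity
      linarith
  rw [abs_mul, abs_of_nonneg (hw x)]
  refine (mul_le_mul_of_nonneg_left hbound (hw x)).trans ?_
  rw [hsplit]
  have hkk : k = w x * cdKernel μ n x x := weightedKernel_self hw n x
  have h4 := mul_le_mul_of_nonneg_left hnearint (by positivity : 0 ≤ 2 * M)
  calc _ = e * (w x * cdKernel μ n x x) + 2 * M * (w x * cdKernel μ n x x) -
        2 * M * (w x * ∫ y in S, cdKernel μ n x y ^ 2 ∂μ) := by ring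
    _ ≤ e * k + 2 * M * k - 2 * M *
        (k * ∫ b in -A..A, (weightedKernel μ w n x (x + b / k) / k) ^ 2) := by
          rw [← hkk]; linarith
    _ = _ := by ring

/-- Integration of a function supported where `μ` is absolutely continuous, in rescaled
coordinates. -/
theorem integral_eq_rescaled {w : ℝ → ℝ} (hwm : Measurable w) (hw : ∀ x, 0 ≤ w x)
    {ν : Measure ℝ} (hμ : μ = volume.withDensity (fun x => ENNReal.ofReal (w x)) + ν)
    {xs c R : ℝ} (hc : 0 < c) (hR : 0 ≤ R) (hν : ν (Set.Icc (xs - c * R) (xs + c * R)) = 0)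
    {g : ℝ → ℝ} (hg : ∀ x, x ∉ Set.Icc (xs - c * R) (xs + c * R) → g x = 0) :
    ∫ x, g x ∂μ = c * ∫ u in -R..R, w (xs + c * u) * g (xs + c * u) := by
  have hcR : 0 ≤ c * R := by positivity
  rw [← setIntegral_eq_integral_of_forall_compl_eq_zero hg, hμ, Measure.restrict_add,
    Measure.restrict_eq_zero.2 hν, add_zero,
    setIntegral_withDensity_eq_setIntegral_toReal_smul hwm.ennreal_ofReal
      (ae_of_all _ fun _ => ENNReal.ofReal_lt_top) _ measurableSet_Icc]
  simp only [ENNReal.toReal_ofReal (hw _), smul_eq_mul]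
  rw [integral_Icc_eq_integral_Ioc, ← intervalIntegral.integral_of_le (by linarith),
    intervalIntegral.mul_integral_comp_add_mul (f := fun x => w x * g x)]
  congr 1
  ring

/-- `f` is glued to itself along its finite, hence closed, set of discontinuities. -/
theorem measurable_of_finite_discontinuities {f : ℝ → ℝ}
    (hf : {x : ℝ | ¬ ContinuousAt f x}.Finite) : Measurable f := by
  classical
  have h := ContinuousOn.measurable_piecewise (hf.continuousOn f)
    (g := f) (fun x hx => (not_not.1 hx : ContinuousAt f x).continuousWithinAt) hf.measurableSet
  rwa [Set.piecewise_same] at h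

/-- Pointwise `s² - r² = 2s(s - r) - (s - r)² ≤ 2δ`, integrated over an interval of length `2A`. -/
theorem integral_sq_ge_of_abs_sub_le {A δ : ℝ} (hA : 0 ≤ A) {r s : ℝ → ℝ}
    (hr : Measurable r) (hs : Continuous s) (hs1 : ∀ b, |s b| ≤ 1)
    (h : ∀ b ∈ Set.Icc (-A) A, |s b - r b| ≤ δ) :
    (∫ b in -A..A, s b ^ 2) - 4 * A * δ ≤ ∫ b in -A..A, r b ^ 2 := by
  have hle : -A ≤ A := by linarith
  have hint : IntervalIntegrable (fun b => r b ^ 2) volume (-A) A := by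
    rw [intervalIntegrable_iff, Set.uIoc_of_le hle]
    refine IntegrableOn.of_bound (by simp) (hr.pow_const 2).aestronglyMeasurable ((1 + δ) ^ 2) ?_
    filter_upwards [ae_restrict_mem measurableSet_Ioc] with b hb
    have h1 := h b ⟨hb.1.le, hb.2⟩
    rw [norm_pow, Real.norm_eq_abs]
    refine pow_le_pow_left₀ (abs_nonneg _) ?_ 2
    have h2 := hs1 b
    rw [abs_le] at h1 h2 ⊢
    constructor <;> linarith
  have hc : (∫ b in -A..A, s b ^ 2) - 4 * A * δ = ∫ b in -A..A, (s b ^ 2 - 2 * δ) := by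
    have hsi : IntervalIntegrable (fun b => s b ^ 2) volume (-A) A :=
      (hs.pow 2).intervalIntegrable _ _
    rw [intervalIntegral.integral_sub hsi intervalIntegrable_const]
    simp
    ring
  rw [hc]
  refine intervalIntegral.integral_mono_on hle
    (((hs.pow 2).intervalIntegrable _ _).sub intervalIntegrable_const) hint fun b hb => ?_
  have h1 := h b hb
  have h3 : |s b * (s b - r b)| ≤ δ := by
    rw [abs_mul]
    calc |s b| * |s b - r b| ≤ 1 * δ :=
          mul_le_mul (hs1 b) h1 (abs_nonneg _) zero_le_one
      _ = δ := one_mul δ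
  have h4 := (abs_le.1 h3).2
  nlinarith [sq_nonneg (s b - r b)]

/-! ### The local regime and rescaling around the reference point -/

/-- The hypotheses of the local law: near `xs` the measures are absolutely continuous, with
converging weighted Christoffel functions and sine kernel universality. -/
structure LocalRegime (μ μsing : ℕ → Measure ℝ) (w : ℕ → ℝ → ℝ) (I : Set ℝ) (xs : ℝ)
    (ρ : ℝ → ℝ) : Prop where
  prob : ∀ n, 1 ≤ n → IsProbabilityMeasure (μ n)
  mom : ∀ n, 1 ≤ n → FiniteMoments (μ n)
  weight_meas : ∀ n, 1 ≤ n → Measurable (w n)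
  weight_nonneg : ∀ n, 1 ≤ n → ∀ x, 0 ≤ w n x
  decomp : ∀ n, 1 ≤ n →
    μ n = volume.withDensity (fun x => ENNReal.ofReal (w n x)) + μsing n
  mem_interior : xs ∈ interior I
  subset_support : ∀ n, 1 ≤ n → I ⊆ (μ n).support
  sing_eq_zero : ∀ n, 1 ≤ n → μsing n I = 0
  density_cont : ContinuousOn ρ I
  density_pos : 0 < ρ xs
  density : TendstoUniformlyOn
    (fun (n : ℕ) (x : ℝ) => weightedKernel (μ n) (w n) n x x / n) ρ atTop I
  universality : ∀ C : Set ℝ, IsCompact C → TendstoUniformlyOn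
    (fun (n : ℕ) (p : ℝ × ℝ × ℝ) =>
      weightedKernel (μ n) (w n) n
          (p.1 + p.2.1 / weightedKernel (μ n) (w n) n p.1 p.1)
          (p.1 + p.2.2 / weightedKernel (μ n) (w n) n p.1 p.1) /
        weightedKernel (μ n) (w n) n p.1 p.1)
    (fun p => Real.sinc (Real.pi * (p.2.2 - p.2.1))) atTop (I ×ˢ C ×ˢ C)

/-- The point `xs + n^{-α} u`. -/
noncomputable def zoom (α xs : ℝ) (n : ℕ) (u : ℝ) : ℝ := xs + ((n : ℝ) ^ α)⁻¹ * u

/-- The rescaled test function `x ↦ f (n^α (x - xs))`. -/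
noncomputable def rescale (f : ℝ → ℝ) (α xs : ℝ) (n : ℕ) (x : ℝ) : ℝ :=
  f ((n : ℝ) ^ α * (x - xs))

theorem measurable_rescale {f : ℝ → ℝ} (hf : Measurable f) (α xs : ℝ) (n : ℕ) :
    Measurable (rescale f α xs n) := by
  unfold rescale; fun_prop

theorem rpow_natCast_pos (α : ℝ) {n : ℕ} (hn : 1 ≤ n) : 0 < (n : ℝ) ^ α :=
  Real.rpow_pos_of_pos (by exact_mod_cast hn) α

theorem rescale_zoom (f : ℝ → ℝ) (α xs : ℝ) {n : ℕ} (hn : 1 ≤ n) (u : ℝ) :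
    rescale f α xs n (zoom α xs n u) = f u := by
  rw [rescale, zoom, add_sub_cancel_left, mul_inv_cancel_left₀ (rpow_natCast_pos α hn).ne']

theorem measurable_zoom (α xs : ℝ) (n : ℕ) : Measurable (zoom α xs n) := by
  unfold zoom; fun_prop

theorem tendsto_inv_rpow_natCast {α : ℝ} (hα : 0 < α) :
    Tendsto (fun n : ℕ => ((n : ℝ) ^ α)⁻¹) atTop (𝓝 0) :=
  ((tendsto_rpow_atTop hα).comp tendsto_natCast_atTop_atTop).inv_tendsto_atTop

theorem tendsto_rpow_natCast_div {α : ℝ} (hα1 : α < 1) :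
    Tendsto (fun n : ℕ => (n : ℝ) ^ α / n) atTop (𝓝 0) := by
  refine (tendsto_inv_rpow_natCast (sub_pos.2 hα1)).congr' ?_
  filter_upwards [eventually_ge_atTop 1] with n hn
  have hn0 : (0 : ℝ) < n := by exact_mod_cast hn
  rw [← Real.rpow_neg hn0.le, neg_sub, Real.rpow_sub hn0, Real.rpow_one]

theorem tendsto_zoom {α : ℝ} (hα : 0 < α) (xs u : ℝ) :
    Tendsto (fun n => zoom α xs n u) atTop (𝓝 xs) := by
  simpa [zoom] using ((tendsto_inv_rpow_natCast hα).mul_const u).const_add xs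

namespace LocalRegime

variable {μ μsing : ℕ → Measure ℝ} {w : ℕ → ℝ → ℝ} {I : Set ℝ} {xs : ℝ} {ρ : ℝ → ℝ}

theorem support_infinite (h : LocalRegime μ μsing w I xs ρ) {n : ℕ} (hn : 1 ≤ n) :
    (μ n).support.Infinite :=
  (infinite_of_mem_nhds xs (mem_interior_iff_mem_nhds.1 h.mem_interior)).mono
    (h.subset_support n hn)

theorem withDensity_le (h : LocalRegime μ μsing w I xs ρ) {n : ℕ} (hn : 1 ≤ n) :
    volume.withDensity (fun x => ENNReal.ofReal (w n x)) ≤ μ n := by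
  conv_rhs => rw [h.decomp n hn]
  exact Measure.le_add_right le_rfl

theorem exists_good_radius (h : LocalRegime μ μsing w I xs ρ) :
    ∃ r > 0, ∀ x, |x - xs| ≤ r → x ∈ I ∧ |ρ x| ≤ ρ xs + 1 := by
  have hI := mem_interior_iff_mem_nhds.1 h.mem_interior
  have hc : ContinuousAt ρ xs := h.density_cont.continuousAt hI
  have h2 : ∀ᶠ x in 𝓝 xs, |ρ x| < ρ xs + 1 := by
    refine hc.abs.eventually_lt_const ?_
    change |ρ xs| < ρ xs + 1
    rw [abs_of_pos h.density_pos]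
    linarith
  obtain ⟨r, hr, hball⟩ := Metric.nhds_basis_closedBall.eventually_iff.1
    ((eventually_mem_set.2 hI).and h2)
  refine ⟨r, hr, fun x hx => ?_⟩
  have := hball (show x ∈ Metric.closedBall xs r by rwa [Metric.mem_closedBall, Real.dist_eq])
  exact ⟨this.1, this.2.le⟩

theorem eventually_zoom_mem {α : ℝ} (hα : 0 < α) {r : ℝ} (hr : 0 < r) (R : ℝ) :
    ∀ᶠ n : ℕ in atTop, ∀ u, |u| ≤ R → |zoom α xs n u - xs| ≤ r := by
  have h1 := ((tendsto_inv_rpow_natCast hα).mul_const R).eventually_lt_const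
    (show 0 * R < r by simpa using hr)
  filter_upwards [h1] with n hn u hu
  have h2 : 0 ≤ ((n : ℝ) ^ α)⁻¹ := by positivity
  rw [zoom, add_sub_cancel_left, abs_mul, abs_of_nonneg h2]
  exact (mul_le_mul_of_nonneg_left hu h2).trans hn.le

theorem tendsto_kernel_zoom (h : LocalRegime μ μsing w I xs ρ) {α : ℝ} (hα : 0 < α) (u : ℝ) :
    Tendsto (fun n : ℕ => weightedKernel (μ n) (w n) n (zoom α xs n u) (zoom α xs n u) / n)
      atTop (𝓝 (ρ xs)) := by
  have hI := mem_interior_iff_mem_nhds.1 h.mem_interior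
  refine tendsto_comp_of_locally_uniform_limit_within
    (F := fun (n : ℕ) (x : ℝ) => weightedKernel (μ n) (w n) n x x / n) (s := I)
    (h.density_cont.continuousAt hI).continuousWithinAt
    (tendsto_nhdsWithin_iff.2 ⟨tendsto_zoom hα xs u, (tendsto_zoom hα xs u).eventually hI⟩)
    fun U hU => ⟨I, self_mem_nhdsWithin, h.density U hU⟩

/-- Universality with first offset `0` and second offset `b` in `[-A, A]`. Uniformity over `I` is
what allows the base point `x n` to move with `n`. -/
theorem eventually_integral_kernel_ratio_ge (h : LocalRegime μ μsing w I xs ρ) {x : ℕ → ℝ}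
    (hx : ∀ᶠ n in atTop, x n ∈ I) {A : ℝ} (hA : 0 ≤ A) {η : ℝ} (hη : 0 < η) :
    ∀ᶠ n : ℕ in atTop, (∫ b in -A..A, Real.sinc (Real.pi * b) ^ 2) - η ≤
      ∫ b in -A..A, (weightedKernel (μ n) (w n) n (x n)
        (x n + b / weightedKernel (μ n) (w n) n (x n) (x n)) /
          weightedKernel (μ n) (w n) n (x n) (x n)) ^ 2 := by
  -- Makes the loss `4 A δ` at most `η`; the `+ 1` covers `A = 0`.
  set δ := η / (4 * A + 1) with hδ
  have hδ0 : 0 < δ := by positivity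
  have hδη : 4 * A * δ ≤ η := by
    rw [hδ, mul_div_assoc', div_le_iff₀ (by positivity)]
    nlinarith
  have hu := Metric.tendstoUniformlyOn_iff.1 (h.universality (Set.Icc (-A) A) isCompact_Icc) δ hδ0
  filter_upwards [hx, hu, eventually_ge_atTop 1] with n hxn hn hn1
  refine le_trans (by linarith) (integral_sq_ge_of_abs_sub_le hA (δ := δ)
    (s := fun b => Real.sinc (Real.pi * b)) ?_ ?_ (fun b => Real.abs_sinc_le_one _) ?_)
  · have h1 := (continuous_cdKernel (μ n) n).measurable
    have h2 := h.weight_meas n hn1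
    have h3 : Measurable fun y => cdKernel (μ n) n (x n) y :=
      h1.comp measurable_prodMk_left
    have h4 : Measurable fun y => weightedKernel (μ n) (w n) n (x n) y := by
      unfold weightedKernel
      fun_prop
    exact (h4.comp (by fun_prop)).div_const _
  · have := Real.continuous_sinc
    fun_prop
  · intro b hb
    have := hn (x n, 0, b) ⟨hxn, ⟨by linarith, hA⟩, hb⟩
    rw [Real.dist_eq] at this
    simpa using this.le

/-- The rescaled weighted defect vanishes in the limit at the continuity points of `f`. -/
theorem tendsto_weighted_defect (h : LocalRegime μ μsing w I xs ρ) {α : ℝ} (hα : 0 < α)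
    (hα1 : α < 1) {f : ℝ → ℝ} (hf : Measurable f) {M : ℝ} (hM : ∀ x, |f x| ≤ M) {u : ℝ}
    (hu : ContinuousAt f u) :
    Tendsto (fun n : ℕ => w n (zoom α xs n u) *
      defect (μ n) n (rescale f α xs n) (zoom α xs n u) / n) atTop (𝓝 0) := by
  have hM0 : 0 ≤ M := (abs_nonneg _).trans (hM 0)
  have hρ := h.density_pos
  have hk := h.tendsto_kernel_zoom hα u
  have hxI : ∀ᶠ n in atTop, zoom α xs n u ∈ I :=
    (tendsto_zoom hα xs u).eventually (mem_interior_iff_mem_nhds.1 h.mem_interior)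
  refine Metric.tendsto_nhds.2 fun ε hε => ?_
  -- The final bound is `η k + 2M · 2η k` with `k < (ρ xs + 1) n`, that is `η C n = (ε / 2) n`. One
  -- `η` in `2η` comes from truncating the `sinc²` integral at `A`, the other from universality.
  set C := (ρ xs + 1) * (1 + 4 * M) with hC
  have hC0 : 0 < C := by positivity
  set η := ε / (2 * C) with hη
  have hη0 : 0 < η := by positivity
  obtain ⟨A, hA, hA0⟩ := ((tendsto_integral_sinc_sq.eventually_const_lt
    (show 1 - η < 1 by linarith)).and (eventually_ge_atTop 0)).exists
  obtain ⟨d, hd, hfd⟩ := Metric.continuousAt_iff.1 hu η hη0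
  -- The window `A / k` has order `1 / n`; since `α < 1`, it shrinks to zero even in the zoomed
  -- coordinate, so continuity of `f` at `u` applies on it.
  have hwin : Tendsto (fun n : ℕ => (n : ℝ) ^ α *
      (A / weightedKernel (μ n) (w n) n (zoom α xs n u) (zoom α xs n u))) atTop (𝓝 0) := by
    have h1 := ((tendsto_rpow_natCast_div hα1).const_mul A).mul (hk.inv₀ hρ.ne')
    rw [mul_zero, zero_mul] at h1
    refine h1.congr' ?_
    filter_upwards [eventually_ge_atTop 1] with n hn
    have hn0 : (n : ℝ) ≠ 0 := by exact_mod_cast (Nat.one_le_iff_ne_zero.1 hn)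
    rw [inv_div]
    field_simp
  filter_upwards [hk.eventually_const_lt hρ, hk.eventually_lt_const (lt_add_one (ρ xs)),
    hwin.eventually_lt_const hd, h.eventually_integral_kernel_ratio_ge hxI hA0 hη0,
    eventually_ge_atTop 1] with n hkpos hklt hnear hint hn
  have hn0 : (0 : ℝ) < n := by exact_mod_cast hn
  have := h.prob n hn
  set x := zoom α xs n u with hx
  set k := weightedKernel (μ n) (w n) n x x with hkdef
  have hk0 : 0 < k := by
    have := mul_pos hkpos hn0
    rwa [div_mul_cancel₀ _ hn0.ne'] at this
  have hfM : ∀ y, |rescale f α xs n y| ≤ M := fun y => hM _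
  have hα0 := rpow_natCast_pos α hn
  have key := abs_weighted_defect_le_of_near (h.mom n hn) (h.support_infinite hn)
    (h.weight_meas n hn) (h.weight_nonneg n hn) (h.withDensity_le hn)
    (measurable_rescale hf α xs n) hfM hA0 hη0.le hk0 fun y hy => by
      rw [rescale_zoom f α xs hn, abs_sub_comm]
      refine (hfd ?_).le
      refine lt_of_le_of_lt ?_ hnear
      have h1 : (n : ℝ) ^ α * (y - xs) - u = (n : ℝ) ^ α * (y - x) := by
        rw [hx, zoom]
        field_simp
        ring
      rw [Real.dist_eq, h1, abs_mul, abs_of_pos hα0]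
      exact mul_le_mul_of_nonneg_left hy hα0.le
  rw [← hkdef] at key
  set J := ∫ b in -A..A, (weightedKernel (μ n) (w n) n x (x + b / k) / k) ^ 2 with hJ
  have hJ1 : 1 - J ≤ 2 * η := by linarith
  rw [Real.dist_eq, sub_zero, abs_div, abs_of_pos hn0, div_lt_iff₀ hn0]
  have h2 : k < (ρ xs + 1) * n := by rwa [div_lt_iff₀ hn0] at hklt
  calc _ ≤ η * k + 2 * M * (k * (1 - J)) := key
    _ ≤ η * k + 2 * M * (k * (2 * η)) := by gcongr
    _ = (η * (1 + 4 * M)) * k := by ring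
    _ ≤ (η * (1 + 4 * M)) * ((ρ xs + 1) * n) := by gcongr
    _ = η * C * n := by rw [hC]; ring
    _ = ε / 2 * n := by rw [hη]; field_simp
    _ < ε * n := by
      have := mul_pos hε hn0
      linarith

theorem window_subset {α : ℝ} {R : ℝ} {n : ℕ} (hn : 1 ≤ n)
    (hI : ∀ u, |u| ≤ R → zoom α xs n u ∈ I) :
    Set.Icc (xs - ((n : ℝ) ^ α)⁻¹ * R) (xs + ((n : ℝ) ^ α)⁻¹ * R) ⊆ I := by
  intro x hx
  have hα0 := rpow_natCast_pos α hn
  have h1 : zoom α xs n ((n : ℝ) ^ α * (x - xs)) = x := by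
    rw [zoom]; field_simp; ring
  rw [← h1]
  refine hI _ ?_
  rw [abs_mul, abs_of_pos hα0, ← le_inv_mul_iff₀ hα0, abs_le]
  constructor <;> linarith [hx.1, hx.2]

theorem rescale_eq_zero {α : ℝ} {f : ℝ → ℝ} {R : ℝ} (hfR : ∀ u, R < |u| → f u = 0) {n : ℕ}
    (hn : 1 ≤ n) {x : ℝ}
    (hx : x ∉ Set.Icc (xs - ((n : ℝ) ^ α)⁻¹ * R) (xs + ((n : ℝ) ^ α)⁻¹ * R)) :
    rescale f α xs n x = 0 := by
  have hα0 := rpow_natCast_pos α hn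
  refine hfR _ ?_
  by_contra! hle
  refine hx ?_
  rw [abs_mul, abs_of_pos hα0, ← le_inv_mul_iff₀ hα0, abs_le] at hle
  constructor <;> linarith [hle.1, hle.2]

/-- The factor `n^α` cancels the Jacobian of the zoom. Once the window lies in `I`, the singular
part does not charge it and only the density survives. -/
theorem integral_rescale_mul_eq (h : LocalRegime μ μsing w I xs ρ) {α : ℝ} {f : ℝ → ℝ} {R : ℝ}
    (hR : 0 ≤ R) (hfR : ∀ u, R < |u| → f u = 0) {n : ℕ} (hn : 1 ≤ n)
    (hI : ∀ u, |u| ≤ R → zoom α xs n u ∈ I) (g : ℝ → ℝ) :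
    (n : ℝ) ^ α * ∫ x, rescale f α xs n x * g x ∂(μ n) =
      ∫ u in -R..R, f u * (w n (zoom α xs n u) * g (zoom α xs n u)) := by
  have hα0 := rpow_natCast_pos α hn
  rw [integral_eq_rescaled (h.weight_meas n hn) (h.weight_nonneg n hn) (h.decomp n hn)
    (inv_pos.2 hα0) hR (measure_mono_null (window_subset hn hI) (h.sing_eq_zero n hn))
    fun x hx => by rw [rescale_eq_zero hfR hn hx, zero_mul], mul_inv_cancel_left₀ hα0.ne']
  refine intervalIntegral.integral_congr fun u _ => ?_
  change w n (zoom α xs n u) * (rescale f α xs n (zoom α xs n u) * g (zoom α xs n u)) = _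
  rw [rescale_zoom f α xs hn]
  ring

theorem setIntegral_rescale_mul_eq (hIm : MeasurableSet I) {α : ℝ} {f : ℝ → ℝ} {R : ℝ}
    (hR : 0 ≤ R) (hfR : ∀ u, R < |u| → f u = 0) {n : ℕ} (hn : 1 ≤ n)
    (hI : ∀ u, |u| ≤ R → zoom α xs n u ∈ I) (g : ℝ → ℝ) :
    (n : ℝ) ^ α * ∫ x in I, rescale f α xs n x * g x =
      ∫ u in -R..R, f u * g (zoom α xs n u) := by
  have hα0 := rpow_natCast_pos α hn
  have hcR : 0 ≤ ((n : ℝ) ^ α)⁻¹ * R := by positivity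
  rw [setIntegral_eq_of_subset_of_forall_sdiff_eq_zero hIm (window_subset hn hI)
    fun x hx => by rw [rescale_eq_zero hfR hn hx.2, zero_mul],
    integral_Icc_eq_integral_Ioc, ← intervalIntegral.integral_of_le (by linarith),
    ← mul_right_inj' (inv_ne_zero hα0.ne'), inv_mul_cancel_left₀ hα0.ne']
  have h1 := intervalIntegral.mul_integral_comp_add_mul (a := -R) (b := R)
    (f := fun x => rescale f α xs n x * g x) ((n : ℝ) ^ α)⁻¹ xs
  rw [mul_neg, ← sub_eq_add_neg] at h1
  rw [← h1]
  congr 1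
  refine intervalIntegral.integral_congr fun u _ => ?_
  change rescale f α xs n (zoom α xs n u) * g (zoom α xs n u) = _
  rw [rescale_zoom f α xs hn]

end LocalRegime

/-! ### Limits of the variance and of the mean -/

theorem tendsto_integral_mul_of_bounded {f : ℝ → ℝ} (hf : Measurable f) {M : ℝ}
    (hM : ∀ x, |f x| ≤ M) {R B : ℝ} (hR : 0 ≤ R) {F : ℕ → ℝ → ℝ} {G : ℝ → ℝ}
    (hF : ∀ᶠ n in atTop, AEStronglyMeasurable (F n) (volume.restrict (Set.Icc (-R) R)))
    (hB : ∀ᶠ n in atTop, ∀ u, |u| ≤ R → |F n u| ≤ B)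
    (hlim : ∀ᵐ u, Tendsto (fun n => F n u) atTop (𝓝 (G u))) :
    Tendsto (fun n => ∫ u in -R..R, f u * F n u) atTop (𝓝 (∫ u in -R..R, f u * G u)) := by
  have hM0 : 0 ≤ M := (abs_nonneg _).trans (hM 0)
  have hsub : Set.uIoc (-R) R ⊆ Set.Icc (-R) R := by
    rw [Set.uIoc_of_le (by linarith)]
    exact Set.Ioc_subset_Icc_self
  refine intervalIntegral.tendsto_integral_filter_of_dominated_convergence (fun _ => M * B) ?_ ?_
    intervalIntegrable_const ?_
  · filter_upwards [hF] with n hn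
    exact hf.aestronglyMeasurable.mul (hn.mono_measure (Measure.restrict_mono hsub le_rfl))
  · filter_upwards [hB] with n hn
    refine ae_of_all _ fun u hu => ?_
    rw [Real.norm_eq_abs, abs_mul]
    exact mul_le_mul (hM u) (hn u (abs_le.2 (hsub hu))) (abs_nonneg _) hM0
  · filter_upwards [hlim] with u hu _
    exact hu.const_mul _

namespace LocalRegime

variable {μ μsing : ℕ → Measure ℝ} {w : ℕ → ℝ → ℝ} {I : Set ℝ} {xs : ℝ} {ρ : ℝ → ℝ}

/-- Supplies the dominating constants: `|ρ|` is at most `ρ xs + 1` near `xs`, and uniform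
convergence of the density costs at most another `1`. -/
theorem eventually_zoom_mem_and_bounds (h : LocalRegime μ μsing w I xs ρ) {α : ℝ} (hα : 0 < α)
    (R : ℝ) : ∀ᶠ n : ℕ in atTop, ∀ u, |u| ≤ R → zoom α xs n u ∈ I ∧
      |ρ (zoom α xs n u)| ≤ ρ xs + 2 ∧
      weightedKernel (μ n) (w n) n (zoom α xs n u) (zoom α xs n u) / n ≤ ρ xs + 2 := by
  obtain ⟨r, hr, hgood⟩ := h.exists_good_radius
  filter_upwards [eventually_zoom_mem (xs := xs) hα hr R,
    Metric.tendstoUniformlyOn_iff.1 h.density 1 one_pos] with n hz hd u hu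
  obtain ⟨hI, hρ⟩ := hgood _ (hz u hu)
  refine ⟨hI, hρ.trans (by linarith), ?_⟩
  have h1 := hd _ hI
  rw [Real.dist_eq, abs_lt] at h1
  linarith [h1.1, (abs_le.1 hρ).2]

theorem measurable_weightedKernel_self (h : LocalRegime μ μsing w I xs ρ) {n : ℕ} (hn : 1 ≤ n) :
    Measurable fun x => weightedKernel (μ n) (w n) n x x := by
  simp only [weightedKernel_self (h.weight_nonneg n hn)]
  exact (h.weight_meas n hn).mul
    ((continuous_cdKernel (μ n) n).measurable.comp (measurable_id.prodMk measurable_id))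

/-- Dominated convergence in the zoomed variable: `abs_defect_le` gives the domination, and
`tendsto_weighted_defect` the pointwise limit off the finite, hence null, set of discontinuities of
`f`. -/
theorem tendsto_gramVar (h : LocalRegime μ μsing w I xs ρ) {α : ℝ} (hα : 0 < α)
    (hα1 : α < 1) {f : ℝ → ℝ} (hdisc : {x : ℝ | ¬ ContinuousAt f x}.Finite) {M : ℝ}
    (hM : ∀ x, |f x| ≤ M) {R : ℝ} (hR : 0 ≤ R) (hfR : ∀ u, R < |u| → f u = 0) :
    Tendsto (fun n : ℕ => (n : ℝ) ^ α / n * gramVar (μ n) n (rescale f α xs n)) atTop (𝓝 0) := by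
  have hf := measurable_of_finite_discontinuities hdisc
  have hM0 : 0 ≤ M := (abs_nonneg _).trans (hM 0)
  have hbd := h.eventually_zoom_mem_and_bounds hα R
  have key := tendsto_integral_mul_of_bounded hf hM (R := R) (B := 2 * M * (ρ xs + 2)) hR
    (F := fun n u => w n (zoom α xs n u) *
      defect (μ n) n (rescale f α xs n) (zoom α xs n u) / n) (G := fun _ => 0) ?_ ?_ ?_
  · simp only [mul_zero, intervalIntegral.integral_zero] at key
    refine key.congr' ?_
    filter_upwards [hbd, eventually_ge_atTop 1] with n hn hn1
    rw [gramVar_eq (h.mom n hn1) (h.support_infinite hn1) (measurable_rescale hf α xs n)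
      (fun x => hM _), div_mul_eq_mul_div,
      h.integral_rescale_mul_eq hR hfR hn1 fun u hu => (hn u hu).1,
      ← intervalIntegral.integral_div]
    simp only [mul_div_assoc]
  · filter_upwards [eventually_ge_atTop 1] with n hn1
    have := h.prob n hn1
    exact ((((h.weight_meas n hn1).comp (measurable_zoom α xs n)).mul
      ((measurable_defect n (measurable_rescale hf α xs n)).comp
        (measurable_zoom α xs n))).div_const _).aestronglyMeasurable
  · filter_upwards [hbd, eventually_ge_atTop 1] with n hn hn1 u hu
    have hn0 : (0 : ℝ) < n := by exact_mod_cast hn1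
    have h1 := abs_defect_le (h.mom n hn1) (h.support_infinite hn1)
      (measurable_rescale hf α xs n) (fun x => hM _) n (zoom α xs n u)
    have h2 := (hn u hu).2.2
    have hw0 := h.weight_nonneg n hn1 (zoom α xs n u)
    rw [weightedKernel_self (h.weight_nonneg n hn1), div_le_iff₀ hn0] at h2
    rw [abs_div, abs_mul, abs_of_nonneg hw0, abs_of_pos hn0, div_le_iff₀ hn0]
    calc _ ≤ _ := mul_le_mul_of_nonneg_left h1 hw0
      _ = 2 * M * (w n (zoom α xs n u) *
          cdKernel (μ n) n (zoom α xs n u) (zoom α xs n u)) := by ring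
      _ ≤ 2 * M * ((ρ xs + 2) * n) := mul_le_mul_of_nonneg_left h2 (by positivity)
      _ = _ := by ring
  · filter_upwards [compl_mem_ae_iff.2 (hdisc.measure_zero volume)] with u hu
    exact h.tendsto_weighted_defect hα hα1 hf hM (not_not.1 hu)

/-- After zooming, both the mean and the deterministic integral converge to `ρ xs * ∫ f`, so their
difference vanishes. -/
theorem tendsto_mean_sub (h : LocalRegime μ μsing w I xs ρ) (hI : I.OrdConnected) {α : ℝ}
    (hα : 0 < α) {f : ℝ → ℝ} (hf : Measurable f) {M : ℝ}
    (hM : ∀ x, |f x| ≤ M) {R : ℝ} (hR : 0 ≤ R) (hfR : ∀ u, R < |u| → f u = 0) :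
    Tendsto (fun n : ℕ => (n : ℝ) ^ α * ((gram (μ n) n (rescale f α xs n)).trace / n -
      ∫ x in I, rescale f α xs n x * ρ x)) atTop (𝓝 0) := by
  have hbd := h.eventually_zoom_mem_and_bounds hα R
  have key1 := tendsto_integral_mul_of_bounded hf hM (R := R) (B := ρ xs + 2) hR
    (F := fun n u => weightedKernel (μ n) (w n) n (zoom α xs n u) (zoom α xs n u) / n)
    (G := fun _ => ρ xs) ?_ ?_ (ae_of_all _ fun u => h.tendsto_kernel_zoom hα u)
  · have key2 := tendsto_integral_mul_of_bounded hf hM (R := R) (B := ρ xs + 2) hR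
      (F := fun n u => ρ (zoom α xs n u)) (G := fun _ => ρ xs) ?_ ?_ ?_
    · have key := key1.sub key2
      rw [sub_self] at key
      refine key.congr' ?_
      filter_upwards [hbd, eventually_ge_atTop 1] with n hn hn1
      rw [mul_sub, trace_gram (h.mom n hn1) (measurable_rescale hf α xs n) (fun x => hM _),
        mul_div_assoc', h.integral_rescale_mul_eq hR hfR hn1 fun u hu => (hn u hu).1,
        setIntegral_rescale_mul_eq hI.measurableSet hR hfR hn1 fun u hu => (hn u hu).1,
        ← intervalIntegral.integral_div]
      simp only [weightedKernel_self (h.weight_nonneg n hn1), mul_div_assoc]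
    · filter_upwards [hbd] with n hn
      refine ContinuousOn.aestronglyMeasurable ?_ measurableSet_Icc
      refine h.density_cont.comp (Continuous.continuousOn ?_) fun u hu => (hn u (abs_le.2 hu)).1
      unfold zoom
      fun_prop
    · filter_upwards [hbd] with n hn u hu using (hn u hu).2.1
    · have hc := h.density_cont.continuousAt (mem_interior_iff_mem_nhds.1 h.mem_interior)
      exact ae_of_all _ fun u => hc.tendsto.comp (tendsto_zoom hα xs u)
  · filter_upwards [eventually_ge_atTop 1] with n hn1
    exact (((h.measurable_weightedKernel_self hn1).comp
      (measurable_zoom α xs n)).div_const _).aestronglyMeasurable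
  · filter_upwards [hbd, eventually_ge_atTop 1] with n hn hn1 u hu
    rw [abs_of_nonneg]
    · exact (hn u hu).2.2
    · rw [weightedKernel_self (h.weight_nonneg n hn1)]
      have := h.weight_nonneg n hn1 (zoom α xs n u)
      have := cdKernel_self_nonneg (μ n) n (zoom α xs n u)
      positivity

end LocalRegime

/-! ### Deviation bound and almost sure convergence -/

theorem abs_le_supNorm {f : ℝ → ℝ} (hf : ∃ M : ℝ, ∀ x, |f x| ≤ M) (x : ℝ) :
    |f x| ≤ supNorm f := by
  obtain ⟨M, hM⟩ := hf
  exact le_ciSup (f := fun x => |f x|) ⟨M, by rintro _ ⟨y, rfl⟩; exact hM y⟩ x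

theorem summable_exp_neg_mul_rpow {c β : ℝ} (hc : 0 < c) (hβ : 0 < β) :
    Summable fun n : ℕ => Real.exp (-(c * (n : ℝ) ^ β)) := by
  -- The exponent `-2 / β` makes `(n^β)^(-2/β) = n^(-2)`, which is summable.
  have h1 := (isLittleO_exp_neg_mul_rpow_atTop hc (-2 / β)).comp_tendsto
    ((tendsto_rpow_atTop hβ).comp tendsto_natCast_atTop_atTop)
  have h2 : Summable fun n : ℕ => (n : ℝ) ^ (-2 : ℝ) := Real.summable_nat_rpow.2 (by norm_num)
  refine summable_of_isBigO_nat h2 (h1.isBigO.congr (fun n => ?_) fun n => ?_)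
  · simp only [Function.comp_apply, neg_mul]
  · simp only [Function.comp_apply]
    rw [← Real.rpow_mul (Nat.cast_nonneg n), mul_div_cancel₀ _ hβ.ne']

namespace LocalRegime

variable {μ μsing : ℕ → Measure ℝ} {w : ℕ → ℝ → ℝ} {I : Set ℝ} {xs : ℝ} {ρ : ℝ → ℝ}

theorem eventually_measure_deviation_le (h : LocalRegime μ μsing w I xs ρ) {α : ℝ} (hα : 0 < α)
    (hα1 : α < 1) {f : ℝ → ℝ} (hbdd : ∃ M : ℝ, ∀ x, |f x| ≤ M)
    (hdisc : {x : ℝ | ¬ ContinuousAt f x}.Finite)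
    {R : ℝ} (hR : 0 ≤ R) (hfR : ∀ u, R < |u| → f u = 0) {ε : ℝ} (hε : 0 < ε) :
    ∀ᶠ n : ℕ in atTop, ensemble (μ n) n
      {l | ε ≤ (n : ℝ) ^ α * |localStat f α xs n l / n -
        (∫ l', localStat f α xs n l' ∂(ensemble (μ n) n)) / n|} ≤
      ENNReal.ofReal (2 * Real.exp (-(ε * (n : ℝ) ^ (1 - α) / (6 * supNorm f)))) := by
  have hf := measurable_of_finite_discontinuities hdisc
  have hM := abs_le_supNorm hbdd
  set M := supNorm f with hMdef
  rcases ((abs_nonneg _).trans (hM 0)).eq_or_lt with hM0 | hM0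
  -- When `supNorm f = 0`, division by zero makes the exponent `0`, and the right-hand side is the
  -- trivial bound `2`.
  · filter_upwards [eventually_ge_atTop 1] with n hn
    have := h.prob n hn
    have := isProbabilityMeasure_ensemble (h.mom n hn) (h.support_infinite hn) n
    refine prob_le_one.trans ?_
    rw [← hM0, mul_zero, div_zero, neg_zero, Real.exp_zero, ← ENNReal.ofReal_one]
    exact ENNReal.ofReal_le_ofReal (by norm_num)
  -- With `s = ε n^{1-α}` this threshold means `V ≤ 3Ms/2`. For `t = 1 / (3M)`, where `t · 2M = 2/3
  -- ≤ 1`, the Chernoff exponent `-s/(3M) + V/(9M²)` is then at most `-s/(6M)`.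
  have hV := (h.tendsto_gramVar hα hα1 hdisc hM hR hfR).eventually_lt_const
    (show 0 < 3 * M * ε / 2 by positivity)
  filter_upwards [hV, eventually_ge_atTop 1] with n hVn hn
  have := h.prob n hn
  have := isProbabilityMeasure_ensemble (h.mom n hn) (h.support_infinite hn) n
  have hn0 : (0 : ℝ) < n := by exact_mod_cast hn
  have hα0 := rpow_natCast_pos α hn
  set s := ε * (n : ℝ) ^ (1 - α) with hs
  have hsn : s * (n : ℝ) ^ α = ε * n := by
    rw [hs, mul_assoc, ← Real.rpow_add hn0, sub_add_cancel, Real.rpow_one]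
  set V := gramVar (μ n) n (rescale f α xs n) with hVdef
  have key := measureReal_linearStat_sub_integral_ge_le (h.mom n hn) (h.support_infinite hn)
    (measurable_rescale hf α xs n) (M := M) (fun x => hM _) (t := 1 / (3 * M)) (by positivity)
    (by field_simp; norm_num) n s
  have hset : {l : Fin n → ℝ | ε ≤ (n : ℝ) ^ α * |localStat f α xs n l / n -
        (∫ l', localStat f α xs n l' ∂(ensemble (μ n) n)) / n|} =
      {l | s ≤ |∑ j, rescale f α xs n (l j) -
        ∫ l', ∑ j, rescale f α xs n (l' j) ∂(ensemble (μ n) n)|} := by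
    ext l
    simp only [Set.mem_ofPred_eq]
    rw [← sub_div, abs_div, abs_of_pos hn0, mul_div_assoc', le_div_iff₀ hn0, ← hsn, mul_comm s,
      mul_le_mul_iff_right₀ hα0]
    rfl
  rw [hset, ← ofReal_measureReal]
  refine ENNReal.ofReal_le_ofReal (key.trans ?_)
  refine mul_le_mul_of_nonneg_left (Real.exp_le_exp.2 ?_) (by norm_num)
  have hVs : V ≤ 3 * M * s / 2 := by
    rw [div_mul_eq_mul_div, div_lt_iff₀ hn0] at hVn
    refine le_of_mul_le_mul_left ?_ hα0
    calc (n : ℝ) ^ α * V ≤ 3 * M / 2 * (ε * n) := by linarith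
      _ = _ := by rw [← hsn]; ring
  calc -(1 / (3 * M)) * s + (1 / (3 * M)) ^ 2 * V
      ≤ -(1 / (3 * M)) * s + (1 / (3 * M)) ^ 2 * (3 * M * s / 2) := by gcongr
    _ = -(s / (6 * M)) := by field_simp; ring

/-- Only the convergent half of Borel–Cantelli is used. It needs no independence, so the joint law
of the different sizes plays no role. -/
theorem ae_tendsto_local_law (h : LocalRegime μ μsing w I xs ρ) (hI : I.OrdConnected) {α : ℝ}
    (hα : 0 < α) (hα1 : α < 1) {f : ℝ → ℝ} (hbdd : ∃ M : ℝ, ∀ x, |f x| ≤ M)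
    (hdisc : {x : ℝ | ¬ ContinuousAt f x}.Finite)
    {R : ℝ} (hR : 0 ≤ R) (hfR : ∀ u, R < |u| → f u = 0) {Ω : Type*} [MeasurableSpace Ω]
    (P : Measure Ω) (L : (n : ℕ) → Ω → (Fin n → ℝ))
    (hL : ∀ n, 1 ≤ n → HasLaw (L n) (ensemble (μ n) n) P) :
    ∀ᵐ ω ∂P, Tendsto
      (fun n : ℕ => (n : ℝ) ^ α * (localStat f α xs n (L n ω) / n -
        ∫ x in I, f ((n : ℝ) ^ α * (x - xs)) * ρ x)) atTop (𝓝 0) := by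
  have hf := measurable_of_finite_discontinuities hdisc
  have hM := abs_le_supNorm hbdd
  rcases ((abs_nonneg _).trans (hM 0)).eq_or_lt with hM0 | hM0
  · have hf0 : ∀ x, f x = 0 := fun x => abs_nonpos_iff.1 ((hM x).trans hM0.ge)
    refine ae_of_all _ fun ω => ?_
    simp [localStat, hf0]
  set D : (n : ℕ) → (Fin n → ℝ) → ℝ := fun n l => (n : ℝ) ^ α * |localStat f α xs n l / n -
    (∫ l', localStat f α xs n l' ∂(ensemble (μ n) n)) / n| with hD
  have hDm : ∀ n, Measurable (D n) := by
    intro n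
    have : Measurable fun l : Fin n → ℝ => localStat f α xs n l := by
      unfold localStat; fun_prop
    simp only [hD]
    fun_prop
  have hev : ∀ ε : ℝ, 0 < ε → ∀ᵐ ω ∂P, ∀ᶠ n in atTop, D n (L n ω) < ε := by
    intro ε hε
    obtain ⟨N, hN⟩ := eventually_atTop.1
      (h.eventually_measure_deviation_le hα hα1 hbdd hdisc hR hfR hε)
    set c := ε / (6 * supNorm f) with hc
    have hc0 : 0 < c := by positivity
    -- The cutoff empties the first few events, so that the tail bound, valid only for large `n`,
    -- holds for every `n`.
    set S : ℕ → Set Ω := fun n => {ω | max N 1 ≤ n ∧ ε ≤ D n (L n ω)} with hS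
    have hSle : ∀ n, P (S n) ≤
        ENNReal.ofReal (2 * Real.exp (-(c * (n : ℝ) ^ (1 - α)))) := by
      intro n
      by_cases hn : max N 1 ≤ n
      · have h1 : S n = {ω | ε ≤ D n (L n ω)} := by
          ext ω; simp only [hS, Set.mem_ofPred_eq, hn, true_and]
        rw [h1, (hL n (le_of_max_le_right hn)).measure_eq (p := fun l => ε ≤ D n l)
          (measurableSet_le measurable_const (hDm n))]
        refine (hN n (le_of_max_le_left hn)).trans (le_of_eq ?_)
        rw [hc]
        congr 4
        ring
      · have h1 : S n = ∅ := by
          ext ω; simp only [hS, Set.mem_ofPred_eq, hn, false_and, Set.mem_empty_iff_false]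
        rw [h1, measure_empty]
        exact bot_le
    have hsum : ∑' n, P (S n) ≠ ⊤ := by
      refine ne_top_of_le_ne_top ?_ (ENNReal.tsum_le_tsum hSle)
      exact ((summable_exp_neg_mul_rpow hc0 (sub_pos.2 hα1)).mul_left 2).tsum_ofReal_ne_top
    filter_upwards [ae_eventually_notMem hsum] with ω hω
    filter_upwards [hω, eventually_ge_atTop (max N 1)] with n hn hn1
    by_contra! hle
    exact hn ⟨hn1, hle⟩
  -- A countable sequence of tolerances yields a single null set valid for all `ε`.
  have hall : ∀ᵐ ω ∂P, ∀ k : ℕ, ∀ᶠ n in atTop, D n (L n ω) < 1 / ((k : ℝ) + 1) :=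
    ae_all_iff.2 fun k => hev _ Nat.one_div_pos_of_nat
  filter_upwards [hall] with ω hω
  have h1 : Tendsto (fun n : ℕ => (n : ℝ) ^ α * (localStat f α xs n (L n ω) / n -
      (∫ l', localStat f α xs n l' ∂(ensemble (μ n) n)) / n)) atTop (𝓝 0) := by
    refine Metric.tendsto_nhds.2 fun ε hε => ?_
    obtain ⟨k, hk⟩ := exists_nat_one_div_lt hε
    filter_upwards [hω k] with n hn
    rw [Real.dist_eq, sub_zero, abs_mul, abs_of_nonneg (by positivity : 0 ≤ (n : ℝ) ^ α)]
    exact hn.trans hk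
  have h2 := h1.add (h.tendsto_mean_sub hI hα hf hM hR hfR)
  rw [add_zero] at h2
  refine h2.congr' ?_
  filter_upwards [eventually_ge_atTop 1] with n hn
  have := h.prob n hn
  have h3 := integral_linearStat (h.mom n hn) (h.support_infinite hn)
    (measurable_rescale hf α xs n) (fun x => hM _) n
  have h4 : ∫ l', localStat f α xs n l' ∂(ensemble (μ n) n) =
      (gram (μ n) n (rescale f α xs n)).trace := h3
  rw [h4, ← mul_add, sub_add_sub_cancel]
  rfl

end LocalRegime

end OPE

theorem mainTheorem2
    (μ μsing : ℕ → Measure ℝ) (w : ℕ → ℝ → ℝ)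
    (hprob : ∀ n, 1 ≤ n → IsProbabilityMeasure (μ n))
    (hmom : ∀ n, 1 ≤ n → OPE.FiniteMoments (μ n))
    (hw_meas : ∀ n, 1 ≤ n → Measurable (w n))
    (hw_nonneg : ∀ n, 1 ≤ n → ∀ x, 0 ≤ w n x)
    (hsing : ∀ n, 1 ≤ n → μsing n ⟂ₘ volume)
    (hdecomp : ∀ n, 1 ≤ n →
      μ n = volume.withDensity (fun x => ENNReal.ofReal (w n x)) + μsing n)
    (I : Set ℝ) (hI : I.OrdConnected) (xs : ℝ) (hxs : xs ∈ interior I)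
    (hI_supp : ∀ n, 1 ≤ n → I ⊆ (μ n).support)
    (hI_sing : ∀ n, 1 ≤ n → μsing n I = 0)
    (hw_pos : ∀ n, 1 ≤ n → 0 < w n xs)
    (ρ : ℝ → ℝ) (hρ_cont : ContinuousOn ρ I) (hρ_pos : 0 < ρ xs)
    (hdensity : TendstoUniformlyOn
      (fun (n : ℕ) (x : ℝ) => OPE.weightedKernel (μ n) (w n) n x x / n) ρ atTop I)
    (huniv : ∀ C : Set ℝ, IsCompact C → TendstoUniformlyOn
      (fun (n : ℕ) (p : ℝ × ℝ × ℝ) =>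
        OPE.weightedKernel (μ n) (w n) n
            (p.1 + p.2.1 / OPE.weightedKernel (μ n) (w n) n p.1 p.1)
            (p.1 + p.2.2 / OPE.weightedKernel (μ n) (w n) n p.1 p.1) /
          OPE.weightedKernel (μ n) (w n) n p.1 p.1)
      (fun p => Real.sinc (Real.pi * (p.2.2 - p.2.1))) atTop (I ×ˢ C ×ˢ C))
    (α : ℝ) (hα_pos : 0 < α) (hα_lt : α < 1)
    (f : ℝ → ℝ) (hf_bdd : ∃ M : ℝ, ∀ x, |f x| ≤ M) (hf_supp : HasCompactSupport f)
    (hf_disc : {x : ℝ | ¬ ContinuousAt f x}.Finite) :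
    (∀ ε : ℝ, 0 < ε → ∀ᶠ n : ℕ in atTop,
      OPE.ensemble (μ n) n
          {l | ε ≤ (n : ℝ) ^ α * |OPE.localStat f α xs n l / n -
            (∫ l', OPE.localStat f α xs n l' ∂(OPE.ensemble (μ n) n)) / n|} ≤
        ENNReal.ofReal
          (2 * Real.exp (-(ε * (n : ℝ) ^ (1 - α) / (6 * OPE.supNorm f))))) ∧
    (∀ {Ω : Type*} [MeasurableSpace Ω] (P : Measure Ω) [IsProbabilityMeasure P]
      (L : (n : ℕ) → Ω → (Fin n → ℝ)),
      (∀ n, 1 ≤ n → HasLaw (L n) (OPE.ensemble (μ n) n) P) →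
      ∀ᵐ ω ∂P, Tendsto
        (fun n : ℕ => (n : ℝ) ^ α * (OPE.localStat f α xs n (L n ω) / n -
          ∫ x in I, f ((n : ℝ) ^ α * (x - xs)) * ρ x)) atTop (𝓝 0)) := by
  have h : OPE.LocalRegime μ μsing w I xs ρ :=
    ⟨hprob, hmom, hw_meas, hw_nonneg, hdecomp, hxs, hI_supp, hI_sing, hρ_cont, hρ_pos, hdensity,
      huniv⟩
  obtain ⟨R, hR, hfR⟩ : ∃ R : ℝ, 0 ≤ R ∧ ∀ u, R < |u| → f u = 0 := by
    obtain ⟨R, hR⟩ := hf_supp.isCompact.isBounded.subset_closedBall 0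
    refine ⟨max R 0, le_max_right _ _, fun u hu => ?_⟩
    by_contra hne
    have h1 := hR (subset_tsupport f hne)
    rw [mem_closedBall_zero_iff, Real.norm_eq_abs] at h1
    exact absurd (h1.trans (le_max_left R 0)) (not_le.2 hu)
  exact ⟨fun ε hε => h.eventually_measure_deviation_le hα_pos hα_lt hf_bdd hf_disc hR hfR hε,
    fun P _ L hL => h.ae_tendsto_local_law hI hα_pos hα_lt hf_bdd hf_disc hR hfR P L hL⟩
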